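/- **Setting.** A transmitter serves two receivers DR1 and DR2, $l\in\{1,2\}$, with the help of a reconfigurable surface of which $M_l\ge 1$ elements serve DR$l$. The channels are $h_l$ (direct link), $\bar g_l^{i}$ and $g_l^{i}$ ($1\le i\le M_l$; to and from the $i$-th element). Their magnitudes are Nakagami distributed, with shape and spread parameters $(m_{h_l},\Omega_{h_l})$, $(m_0,\Omega_g)$ and $(m_l,\Omega_{g_l})$ respectively, all positive, where the Nakagami density is $\frac{2m^m}{\Gamma(m)\Omega^m}x^{2m-1}e^{-mx^2/\Omega}$ for $x>0$; for each $l$ the $2M_l$ magnitudes $|\bar g_l^i|,|g_l^i|$ are independent. Under optimal phase shifts the channel gain is $|\mathcal H_l|^2=\big(|h_l|+\sum_{i=1}^{M_l}|\bar g_l^i||g_l^i|\big)^2$, and without the direct link it is $G_l=\big(\sum_{i=1}^{M_l}|\bar g_l^i||g_l^i|\big)^2$. Let $\rho_r>0$, $\beta_1>0$, $\beta_1^2+\beta_2^2=1$. For channel gain $y$ the SINRs are $\mathrm{SINR}_{DR1}(y)=\beta_1^2\rho_r y$ and $\mathrm{SINR}_{DR2}(y)=\frac{\beta_2^2\rho_r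 y}{\beta_1^2\rho_r y+1}$, and the ergodic rate is $R_{DRl}=\mathbb E[\log_2(1+\mathrm{SINR}_{DRl})]$. **Approximate gain density.** Put $P_l=m_0\Gamma(m_0)^2m_l\Gamma(m_l)^2$, $Q_l=\Gamma(m_0+\tfrac12)^2\Gamma(m_l+\tfrac12)^2$, $$a_l=\frac{M_lP_l}{P_l-Q_l}-M_l-1,\qquad b_l=\frac{P_l-Q_l}{\sqrt{\frac{m_0}{\Omega_g}}\,\Gamma(m_0)\Gamma(m_0+\frac12)\sqrt{\frac{m_l}{\Omega_{g_l}}}\,\Gamma(m_l)\Gamma(m_l+\frac12)},$$ $$f_l(y)=\frac{(\sqrt y)^{\,a_l-1}}{2b_l^{a_l+1}\Gamma(a_l+1)}\,e^{-\sqrt y/b_l}\qquad(y>0).$$ **Claim.** 1. For each $l$, the ergodic rate $R_{DRl}$ with the direct link and the ergodic rate with gain $G_l$ are both finite, and the latter is at most the former. 2. For each $l$, $a_l>-1$, $b_l>0$, and $f_l$ is a probability density that approximates the law of $G_l$ in the sense that $\int_0^\infty \sqrt y f_l(y)\,dy=\mathbb E[\sqrt{G_l}]$ and $\int_0^\infty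 yf_l(y)\,dy=\mathbb E[G_l]<\infty$. 3. Let $R^{l}_{DR1}=\int_0^\infty\log_2(1+\mathrm{SINR}_{DR1}(y))f_1(y)\,dy$ and $R^{l}_{DR2}=\int_0^\infty\log_2(1+\mathrm{SINR}_{DR2}(y))f_2(y)\,dy$ be the approximate lower bounds on the ergodic rates, obtained by dropping the direct link and using the approximate density. (No inequality between these and the exact rates is claimed.) Both integrals converge absolutely. Write, for $c>0$ and $z_c=\frac{-1}{4b^2c\rho_r}$, $$A(c)={}_1F_2\big(1+\tfrac a2;\tfrac32,2+\tfrac a2;z_c\big),\quad B(c)={}_1F_2\big(\tfrac{a+1}2;\tfrac12,\tfrac{a+3}2;z_c\big),\quad C(c)={}_2F_3\big(1,1;2,1-\tfrac a2,\tfrac{3-a}2;z_c\big),$$ and $\psi=\Gamma'/\Gamma$. If $a=a_1\notin\mathbb Z$ and $b=b_1$, then $$R^{l}_{DR1}=\frac1{\ln 2\,\Gamma(a+1)}\Big[\frac{\pi\csc(a\pi/2)\,A(\beta_1^2)}{(a+2)(\beta_1b)^{a+2}\rho_r^{a/2+1}}+\frac{\pi\sec(a\pi/2)\,B(\beta_1^2)}{(a+1)(\beta_1b)^{a+1}\rho_r^{(a+1)/2}}+2a(a-1)\Gamma(a-1)\psi(a+1)+(a^2-a)\Gamma(a-1)\ln(b^2\beta_1^2\rho_r)+\Gamma(a-1)\frac{C(\beta_1^2)}{b^2\beta_1^2\rho_r}\Big].$$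 If $a=a_2\notin\mathbb Z$ and $b=b_2$, then, with $c_1=\beta_1^2+\beta_2^2$ and $c_2=\beta_1^2$, $$R^{l}_{DR2}=\frac1{\ln 2\,\Gamma(a+1)}\Big[\frac{\pi\csc(a\pi/2)}{(a+2)b^{a+2}}\Big\{\frac{A(c_1)}{(c_1\rho_r)^{a/2+1}}-\frac{A(c_2)}{(c_2\rho_r)^{a/2+1}}\Big\}+\frac{\pi\sec(a\pi/2)}{(a+1)b^{a+1}}\Big\{\frac{B(c_1)}{(c_1\rho_r)^{(a+1)/2}}-\frac{B(c_2)}{(c_2\rho_r)^{(a+1)/2}}\Big\}+\Gamma(a-1)\Big\{\frac{C(c_1)}{b^2c_1\rho_r}-\frac{C(c_2)}{b^2c_2\rho_r}\Big\}+(a^2-a)\Gamma(a-1)\ln\frac{c_1}{c_2}\Big].$$ -/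

import Mathlib

open MeasureTheory ProbabilityTheory

noncomputable section

/-- The generalized hypergeometric function `pFq(as; bs; z)` of real parameters and argument, as
the sum of its defining series. -/
def pFq (as bs : List ℝ) (z : ℝ) : ℝ :=
  ∑' n : ℕ, (as.map fun c => (ascPochhammer ℝ n).eval c).prod /
    (bs.map fun c => (ascPochhammer ℝ n).eval c).prod * (z ^ n / (n.factorial : ℝ))

/-- The digamma function on the reals, `ψ = Γ' / Γ`. -/
def realDigamma (x : ℝ) : ℝ := logDeriv Real.Gamma x

/-- The Nakagami-`m` distribution with shape `m` and spread (second moment) `Ω`. -/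
def nakagamiLaw (m Ω : ℝ) : Measure ℝ :=
  volume.withDensity fun x => ENNReal.ofReal <|
    if 0 < x then
      2 * m ^ m / (Real.Gamma m * Ω ^ m) * x ^ (2 * m - 1) * Real.exp (-(m / Ω) * x ^ 2)
    else 0

/-- The link from the transmitter to one receiver: direct channel `h`, channels `gbar i` and `g i`
to and from the `i`-th of the `N` reflecting elements that serve this receiver. All magnitudes are
Nakagami distributed, and those of the reflected channels are mutually independent. -/
structure IsNakagamiLink {S : Type*} [MeasurableSpace S] (P : Measure S) {N : ℕ}
    (h : S → ℂ) (gbar g : Fin N → S → ℂ) (mh Ωh m₀ Ω₀ m Ω : ℝ) : Prop where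
  direct : HasLaw (fun s => ‖h s‖) (nakagamiLaw mh Ωh) P
  incident : ∀ i, HasLaw (fun s => ‖gbar i s‖) (nakagamiLaw m₀ Ω₀) P
  reflected : ∀ i, HasLaw (fun s => ‖g i s‖) (nakagamiLaw m Ω) P
  indep : iIndepFun (Sum.elim (fun i s => ‖gbar i s‖) (fun i s => ‖g i s‖)) P

/-- The channel gain `|H|²` under optimal phase shifts, with the direct link. -/
def gain {S : Type*} {N : ℕ} (h : S → ℂ) (gbar g : Fin N → S → ℂ) (s : S) : ℝ :=
  (‖h s‖ + ∑ i, ‖gbar i s‖ * ‖g i s‖) ^ 2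

/-- The channel gain under optimal phase shifts when the direct link is dropped. -/
def reflectedGain {S : Type*} {N : ℕ} (gbar g : Fin N → S → ℂ) (s : S) : ℝ :=
  (∑ i, ‖gbar i s‖ * ‖g i s‖) ^ 2

/-- SINR of DR1 for its own signal, after cancelling the signal of DR2, as a function of the
channel gain `y`. -/
def sinrDR1 (β₁ ρ y : ℝ) : ℝ := β₁ ^ 2 * y * ρ

/-- SINR of DR2, with the signal of DR1 as interference, as a function of the channel gain `y`. -/
def sinrDR2 (β₁ β₂ ρ y : ℝ) : ℝ := y * β₂ ^ 2 * ρ / (y * β₁ ^ 2 * ρ + 1)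

/-- The instantaneous rate `log₂ (1 + SINR)` in terms of the channel gain. -/
def rate (sinr : ℝ → ℝ) (y : ℝ) : ℝ := Real.logb 2 (1 + sinr y)

/-- The ergodic rate `E[log₂ (1 + SINR)]` when the channel gain has law `ν`. -/
def ergodicRate (ν : Measure ℝ) (sinr : ℝ → ℝ) : ℝ := ∫ y, rate sinr y ∂ν

/-- The parameter `a` of the approximate gain distribution, for `N` reflecting elements. -/
def fitA (N : ℕ) (m₀ m : ℝ) : ℝ :=
  m₀ * Real.Gamma m₀ ^ 2 * N * (m * Real.Gamma m ^ 2) /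
    (m₀ * Real.Gamma m₀ ^ 2 * (m * Real.Gamma m ^ 2) -
      Real.Gamma (m₀ + 1 / 2) ^ 2 * Real.Gamma (m + 1 / 2) ^ 2) - N - 1

/-- The parameter `b` of the approximate gain distribution. -/
def fitB (m₀ Ω₀ m Ω : ℝ) : ℝ :=
  (m₀ * Real.Gamma m₀ ^ 2 * (m * Real.Gamma m ^ 2) -
      Real.Gamma (m₀ + 1 / 2) ^ 2 * Real.Gamma (m + 1 / 2) ^ 2) /
    (√(m₀ / Ω₀) * Real.Gamma m₀ * Real.Gamma (m₀ + 1 / 2) *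
      (√(m / Ω) * Real.Gamma m * Real.Gamma (m + 1 / 2)))

/-- The approximate probability density of the channel gain. -/
def gainPDF (a b y : ℝ) : ℝ :=
  if 0 < y then
    √y ^ (a - 1) / (2 * b ^ (a + 1) * Real.Gamma (a + 1)) * Real.exp (-√y / b)
  else 0

/-- The approximate law of the channel gain. -/
def gainLaw (a b : ℝ) : Measure ℝ := volume.withDensity fun y => ENNReal.ofReal (gainPDF a b y)

/-- `ν` is a probability law on the gains that has the mean gain and the mean amplitude (square
root of the gain) of the law `ν'`, all these means being finite. -/
structure MatchesMeans (ν ν' : Measure ℝ) : Prop where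
  prob : IsProbabilityMeasure ν
  integrable_left : Integrable (fun y : ℝ => y) ν
  integrable_right : Integrable (fun y : ℝ => y) ν'
  mean_gain : ∫ y, y ∂ν = ∫ y, y ∂ν'
  mean_amplitude : ∫ y, √y ∂ν = ∫ y, √y ∂ν'

/-- The argument `-1 / (4 b² c ρ)` of the hypergeometric functions. -/
def hypArg (b c ρ : ℝ) : ℝ := -1 / (4 * b ^ 2 * c * ρ)

/-- `₁F₂(1 + a/2; 3/2, 2 + a/2; -1/(4b²cρ))`. -/
def hypCsc (a b c ρ : ℝ) : ℝ := pFq [1 + a / 2] [3 / 2, 2 + a / 2] (hypArg b c ρ)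

/-- `₁F₂((a+1)/2; 1/2, (a+3)/2; -1/(4b²cρ))`. -/
def hypSec (a b c ρ : ℝ) : ℝ := pFq [(a + 1) / 2] [1 / 2, (a + 3) / 2] (hypArg b c ρ)

/-- `₂F₃(1, 1; 2, 1 - a/2, (3-a)/2; -1/(4b²cρ))`. -/
def hypTail (a b c ρ : ℝ) : ℝ := pFq [1, 1] [2, 1 - a / 2, (3 - a) / 2] (hypArg b c ρ)

/-- The closed form for DR1. -/
def closedFormDR1 (a b β₁ ρ : ℝ) : ℝ :=
  1 / (Real.log 2 * Real.Gamma (a + 1)) *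
    (Real.pi * (1 / Real.sin (a * Real.pi / 2)) * hypCsc a b (β₁ ^ 2) ρ /
        ((a + 2) * (β₁ * b) ^ (a + 2) * ρ ^ (a / 2 + 1))
      + Real.pi * (1 / Real.cos (a * Real.pi / 2)) * hypSec a b (β₁ ^ 2) ρ /
        ((a + 1) * (β₁ * b) ^ (a + 1) * ρ ^ ((a + 1) / 2))
      + 2 * a * (a - 1) * Real.Gamma (a - 1) * realDigamma (a + 1)
      + (a ^ 2 - a) * Real.Gamma (a - 1) * Real.log (b ^ 2 * β₁ ^ 2 * ρ)
      + Real.Gamma (a - 1) * (hypTail a b (β₁ ^ 2) ρ / (b ^ 2 * β₁ ^ 2 * ρ)))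

/-- The closed form for DR2, in terms of `c₁ = β₁² + β₂²` and `c₂ = β₁²`. -/
def closedFormDR2 (a b c₁ c₂ ρ : ℝ) : ℝ :=
  1 / (Real.log 2 * Real.Gamma (a + 1)) *
    (Real.pi * (1 / Real.sin (a * Real.pi / 2)) / ((a + 2) * b ^ (a + 2)) *
        (hypCsc a b c₁ ρ / (c₁ * ρ) ^ (a / 2 + 1) - hypCsc a b c₂ ρ / (c₂ * ρ) ^ (a / 2 + 1))
      + Real.pi * (1 / Real.cos (a * Real.pi / 2)) / ((a + 1) * b ^ (a + 1)) *
        (hypSec a b c₁ ρ / (c₁ * ρ) ^ ((a + 1) / 2) - hypSec a b c₂ ρ / (c₂ * ρ) ^ ((a + 1) / 2))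
      + Real.Gamma (a - 1) *
        (hypTail a b c₁ ρ / (b ^ 2 * c₁ * ρ) - hypTail a b c₂ ρ / (b ^ 2 * c₂ * ρ))
      + (a ^ 2 - a) * Real.Gamma (a - 1) * Real.log (c₁ / c₂))

end

/-!
The rate under the approximate law reduces to a one-parameter integral. Under `gainLaw a b` the
gain is `b² t²` with `t` Gamma distributed of shape `a + 1`, so both rates are combinations of `∫
tᵃ e⁻ᵗ log (1 + κ t²) dt / Γ(a + 1)` (`integral_gainLaw`); for DR2 the rate is a difference of two
logarithms of this kind.

With `κ = s⁻²` put `H(s) = ∫ tᵃ e⁻ᵗ log (s² + t²) dt`. Then `H(0+) = 2 Γ'(a + 1)`, which is where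
the digamma function comes from, and `H'(s) = 2 sᵃ J a s`, where `J a s = ∫ uᵃ e^(-su) / (1 + u²)
du`. The function `J` satisfies `∂ₛ J a = -J (a + 1)` and `J (a + 2) + J a = Γ(a + 1) s^(-a-1)`.
The sum of `(π/2) (sec (aπ/2) cos s + csc (aπ/2) sin s)` and `∑ (-1)ⁿ Γ(a - 1 - 2n) s^(2n + 1 -
a)` satisfies the same two relations. Hence for `-1 < a < 0` the difference `E a` of the two
solves the oscillator system `E a' = -E (a + 1)`, `E (a + 1)' = E a`, the energy `(E a)² + (E (a +
1))²` is constant, and it vanishes because the limits at `s = 0` agree, by Euler's reflection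
formula (`laplaceInt_eq_of_neg`). This covers the non-integers in `(-1, 1)`, and the second
relation extends it to every non-integer `a > -1` (`laplaceInt_eq`). Integrating term by term from
`s = 0` gives `H` (`logMoment_eq`), and its three series are the hypergeometric functions of the
closed forms (`integral_log_one_add_eq`).

The bounds obtained by dropping the direct link are monotonicity of the rate in the gain, all
rates being dominated by a multiple of the integrable gain (`ergodicRate_mono`). The approximate
law has `E √Y = b (a + 1)` and `E Y = b² (a + 1) (a + 2)`. Matching them with the mean and second
moment of a sum of `N` independent copies of `|ḡ| |g|` gives the parameters; `a > -1` and `b > 0`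
come from the strict inequality `Γ(m + 1/2)² < m Γ(m)²` (`Gamma_add_half_sq_lt`).
-/

section
open Set Filter Topology

/-! ### Power series with a real exponent shift -/

/-- The radius of convergence of `∑ c n xⁿ` is infinite. -/
def EntireCoeff (c : ℕ → ℝ) : Prop := ∀ R : ℝ, 0 < R → Summable fun n => |c n| * R ^ n

/-- The generalized power series `∑ c n s^(2n + p)`, for `s > 0` and a real exponent `p`. -/
noncomputable def evenSeries (c : ℕ → ℝ) (p s : ℝ) : ℝ := ∑' n : ℕ, c n * s ^ (2 * (n : ℝ) + p)

lemma rpow_two_mul_add {s : ℝ} (hs : 0 < s) (n : ℕ) (p : ℝ) :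
    s ^ (2 * (n : ℝ) + p) = (s ^ 2) ^ n * s ^ p := by
  rw [Real.rpow_add hs, show (2 * (n : ℝ)) = ((2 * n : ℕ) : ℝ) by push_cast; ring,
    Real.rpow_natCast, pow_mul]

lemma EntireCoeff.summable {c : ℕ → ℝ} (hc : EntireCoeff c) (p : ℝ) {s : ℝ} (hs : 0 < s) :
    Summable fun n : ℕ => c n * s ^ (2 * (n : ℝ) + p) := by
  simp_rw [rpow_two_mul_add hs, ← mul_assoc]
  refine Summable.mul_right _ (Summable.of_norm ?_)
  simpa [abs_mul, abs_of_pos hs] using hc (s ^ 2) (by positivity)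

lemma EntireCoeff.of_abs_le {c d : ℕ → ℝ} (hc : EntireCoeff c) {K : ℝ}
    (h : ∀ n, |d n| ≤ K * |c n|) : EntireCoeff d := fun R hR =>
  Summable.of_nonneg_of_le (fun n => by positivity)
    (fun n => (mul_le_mul_of_nonneg_right (h n) (by positivity)).trans_eq (mul_assoc _ _ _))
    ((hc R hR).mul_left K)

/-- Termwise differentiation multiplies the coefficients by `2n + p` and keeps the radius of
convergence infinite. -/
lemma EntireCoeff.mul_linear {c : ℕ → ℝ} (hc : EntireCoeff c) (p : ℝ) :
    EntireCoeff fun n : ℕ => c n * (2 * (n : ℝ) + p) := by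
  intro R hR
  refine Summable.of_nonneg_of_le (fun n => by positivity) (fun n => ?_)
    ((hc (2 * R) (by positivity)).mul_left (2 + |p|))
  have h1 : |2 * (n : ℝ) + p| ≤ (2 + |p|) * 2 ^ n := by
    have h2 : (n : ℝ) ≤ 2 ^ n := by exact_mod_cast (Nat.lt_two_pow_self (n := n)).le
    have h3 : (1 : ℝ) ≤ 2 ^ n := one_le_pow₀ (by norm_num)
    calc |2 * (n : ℝ) + p| ≤ |2 * (n : ℝ)| + |p| := abs_add_le _ _
      _ = 2 * n + |p| := by rw [abs_of_nonneg (by positivity)]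
      _ ≤ _ := by nlinarith [abs_nonneg p]
  calc |c n * (2 * (n : ℝ) + p)| * R ^ n = |c n| * R ^ n * |2 * (n : ℝ) + p| := by
        rw [abs_mul]; ring
    _ ≤ |c n| * R ^ n * ((2 + |p|) * 2 ^ n) := by gcongr
    _ = _ := by rw [mul_pow]; ring

/-- Generalized power series are differentiated term by term. -/
lemma EntireCoeff.hasDerivAt {c : ℕ → ℝ} (hc : EntireCoeff c) (p : ℝ) {s : ℝ} (hs : 0 < s) :
    HasDerivAt (evenSeries c p) (evenSeries (fun n => c n * (2 * (n : ℝ) + p)) (p - 1) s) s := by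
  set K : ℝ := (s / 2) ^ (p - 1) + (2 * s) ^ (p - 1) with hK
  have hu : Summable fun n : ℕ => K * (|c n * (2 * (n : ℝ) + p)| * ((2 * s) ^ 2) ^ n) :=
    (hc.mul_linear p ((2 * s) ^ 2) (by positivity)).mul_left K
  have hmem : s ∈ Ioo (s / 2) (2 * s) := ⟨by linarith, by linarith⟩
  have hsum := hc.summable p hs
  refine hasDerivAt_tsum_of_isPreconnected
    (g := fun (n : ℕ) (y : ℝ) => c n * y ^ (2 * (n : ℝ) + p))
    (g' := fun (n : ℕ) (y : ℝ) => c n * (2 * (n : ℝ) + p) * y ^ (2 * (n : ℝ) + (p - 1)))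
    hu isOpen_Ioo isPreconnected_Ioo ?_ ?_ hmem hsum hmem
  · intro n y hy
    have hy0 : 0 < y := by linarith [hy.1]
    have := (Real.hasDerivAt_rpow_const (p := 2 * (n : ℝ) + p) (Or.inl hy0.ne')).const_mul (c n)
    refine this.congr_deriv ?_
    rw [← add_sub_assoc]; ring
  · intro n y hy
    have hy0 : 0 < y := by linarith [hy.1]
    have hyK : y ^ (p - 1) ≤ K := by
      rcases le_total 0 (p - 1) with h | h
      · have := Real.rpow_le_rpow hy0.le hy.2.le h
        have : 0 ≤ (s / 2) ^ (p - 1) := by positivity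
        linarith
      · have := Real.rpow_le_rpow_of_nonpos (by positivity : 0 < s / 2) hy.1.le h
        have : 0 ≤ (2 * s) ^ (p - 1) := by positivity
        linarith
    rw [rpow_two_mul_add hy0, norm_mul, Real.norm_eq_abs, Real.norm_eq_abs,
      abs_of_nonneg (by positivity : 0 ≤ (y ^ 2) ^ n * y ^ (p - 1))]
    have : (y ^ 2) ^ n ≤ ((2 * s) ^ 2) ^ n := by gcongr; exact hy.2.le
    calc _ ≤ |c n * (2 * (n : ℝ) + p)| * (((2 * s) ^ 2) ^ n * K) := by gcongr
      _ = _ := by ring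

lemma EntireCoeff.tendsto_zero {c : ℕ → ℝ} (hc : EntireCoeff c) {p : ℝ} (hp : 0 < p) :
    Tendsto (evenSeries c p) (𝓝[>] 0) (𝓝 0) := by
  have hS : Summable fun n => |c n| := by simpa using hc 1 one_pos
  have h1 : Tendsto (fun s : ℝ => (∑' n, |c n|) * s ^ p) (𝓝[>] 0) (𝓝 0) := by
    have := (Real.continuousAt_rpow_const 0 p (Or.inr hp.le)).tendsto.mono_left
      (nhdsWithin_le_nhds (s := Ioi (0 : ℝ)))
    rw [Real.zero_rpow hp.ne'] at this
    simpa using this.const_mul (∑' n, |c n|)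
  refine squeeze_zero_norm' ?_ h1
  filter_upwards [Ioo_mem_nhdsGT (zero_lt_one' ℝ)] with s hs
  rw [← tsum_mul_right]
  refine tsum_of_norm_bounded ((hS.mul_right _).hasSum) fun n => ?_
  rw [rpow_two_mul_add hs.1, norm_mul, Real.norm_eq_abs, Real.norm_eq_abs,
      abs_of_nonneg (mul_nonneg (by positivity) (Real.rpow_nonneg hs.1.le _))]
  have : (s ^ 2) ^ n ≤ 1 := pow_le_one₀ (by positivity) (pow_le_one₀ hs.1.le hs.2.le)
  have h3 : 0 ≤ s ^ p := Real.rpow_nonneg hs.1.le _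
  gcongr
  nlinarith

/-! ### The series with Gamma values at non-integers -/

lemma Gamma_ne_zero_of_not_int {a : ℝ} (ha : ∀ n : ℤ, a ≠ n) (k : ℤ) :
    Real.Gamma (a + k) ≠ 0 :=
  Real.Gamma_ne_zero fun m h => ha (-m - k) (by push_cast; linarith)

/-- The coefficients `(-1)ⁿ Γ(a - 1 - 2n)` of the non-trigonometric part of `laplaceInt`. The
arguments run into the negative axis, where `Γ` is finite because `a` is not an integer. -/
noncomputable def tailCoeff (a : ℝ) (n : ℕ) : ℝ := (-1) ^ n * Real.Gamma (a - 1 - 2 * n)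

lemma tailCoeff_succ {a : ℝ} (ha : ∀ n : ℤ, a ≠ n) (n : ℕ) :
    tailCoeff a n = -((a - 2 - 2 * n) * (a - 3 - 2 * n)) * tailCoeff a (n + 1) := by
  unfold tailCoeff
  have h1 : a - 2 - 2 * n ≠ 0 := fun h => ha (2 + 2 * n) (by push_cast; linarith)
  have h2 : a - 3 - 2 * n ≠ 0 := fun h => ha (3 + 2 * n) (by push_cast; linarith)
  rw [show a - 1 - 2 * (n : ℝ) = (a - 2 - 2 * n) + 1 by ring, Real.Gamma_add_one h1,
    show a - 2 - 2 * (n : ℝ) = (a - 3 - 2 * n) + 1 by ring, Real.Gamma_add_one h2]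
  push_cast
  rw [show a - 1 - 2 * ((n : ℝ) + 1) = a - 3 - 2 * n by ring, pow_succ]
  ring

lemma entireCoeff_tailCoeff {a : ℝ} (ha : ∀ n : ℤ, a ≠ n) : EntireCoeff (tailCoeff a) := by
  intro R hR
  have hne : ∀ n, tailCoeff a n ≠ 0 := fun n => by
    unfold tailCoeff
    refine mul_ne_zero (by simp) ?_
    have := Gamma_ne_zero_of_not_int ha (-1 - 2 * n)
    rwa [show a + ((-1 - 2 * n : ℤ) : ℝ) = a - 1 - 2 * n by push_cast; ring] at this
  refine summable_of_ratio_test_tendsto_lt_one zero_lt_one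
    (Eventually.of_forall fun n => mul_ne_zero (abs_ne_zero.2 (hne n)) (by positivity)) ?_
  have key : ∀ n : ℕ, ‖|tailCoeff a (n + 1)| * R ^ (n + 1)‖ / ‖|tailCoeff a n| * R ^ n‖
      = R * (|a - 2 - 2 * n|⁻¹ * |a - 3 - 2 * n|⁻¹) := by
    intro n
    have h1 : a - 2 - 2 * n ≠ 0 := fun h => ha (2 + 2 * n) (by push_cast; linarith)
    have h2 : a - 3 - 2 * n ≠ 0 := fun h => ha (3 + 2 * n) (by push_cast; linarith)
    have h3 := abs_ne_zero.2 (hne (n + 1))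
    have h1' := abs_ne_zero.2 h1
    have h2' := abs_ne_zero.2 h2
    rw [tailCoeff_succ ha n]
    simp only [Real.norm_eq_abs, abs_mul, abs_abs, abs_neg, abs_pow, abs_of_pos hR]
    field_simp
    rw [pow_succ]
  simp_rw [key]
  have hlim : ∀ k : ℝ, Tendsto (fun n : ℕ => |a - k - 2 * (n : ℝ)|⁻¹) atTop (𝓝 0) := by
    intro k
    refine Tendsto.inv_tendsto_atTop (tendsto_abs_atBot_atTop.comp ?_)
    refine tendsto_atBot_add_const_left _ (a - k)
      (f := fun n : ℕ => -(2 * (n : ℝ))) ?_ |>.congr fun n => by ring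
    exact tendsto_neg_atTop_atBot.comp
      (tendsto_natCast_atTop_atTop.const_mul_atTop (by norm_num))
  simpa using ((hlim 2).mul (hlim 3)).const_mul R

/-- The part of the Laplace transform of `uᵃ / (1 + u²)` that is not trigonometric:
`∑ (-1)ⁿ Γ(a - 1 - 2n) s^(2n + 1 - a)`. -/
noncomputable def laplaceTail (a s : ℝ) : ℝ := evenSeries (tailCoeff a) (1 - a) s

lemma not_int_add {a : ℝ} (ha : ∀ n : ℤ, a ≠ n) (k : ℤ) : ∀ n : ℤ, a + k ≠ n :=
  fun n h => ha (n - k) (by push_cast; linarith)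

lemma hasDerivAt_laplaceTail {a : ℝ} (ha : ∀ n : ℤ, a ≠ n) {s : ℝ} (hs : 0 < s) :
    HasDerivAt (laplaceTail a) (-laplaceTail (a + 1) s) s := by
  have h := (entireCoeff_tailCoeff ha).hasDerivAt (1 - a) hs
  suffices -laplaceTail (a + 1) s = evenSeries _ (1 - a - 1) s by rw [this]; exact h
  unfold laplaceTail evenSeries
  rw [← tsum_neg]
  refine tsum_congr fun n => ?_
  have h1 : a - 1 - 2 * n ≠ 0 := fun h => ha (1 + 2 * n) (by push_cast; linarith)
  unfold tailCoeff
  rw [show a + 1 - 1 - 2 * (n : ℝ) = (a - 1 - 2 * n) + 1 by ring, Real.Gamma_add_one h1,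
    show 1 - (a + 1) = 1 - a - 1 by ring]
  ring

/-- The shift `a ↦ a + 2` moves the series by one index and leaves its first term. -/
lemma laplaceTail_add_two {a : ℝ} (ha : ∀ n : ℤ, a ≠ n) {s : ℝ} (hs : 0 < s) :
    laplaceTail (a + 2) s + laplaceTail a s = Real.Gamma (a + 1) * s ^ (-a - 1) := by
  have h2 : ∀ n : ℤ, a + 2 ≠ n := by simpa using not_int_add ha 2
  unfold laplaceTail evenSeries
  rw [((entireCoeff_tailCoeff h2).summable _ hs).tsum_eq_zero_add]
  have : ∀ n : ℕ, tailCoeff (a + 2) (n + 1) * s ^ (2 * ((n + 1 : ℕ) : ℝ) + (1 - (a + 2)))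
      = -(tailCoeff a n * s ^ (2 * (n : ℝ) + (1 - a))) := by
    intro n
    unfold tailCoeff
    push_cast
    rw [show a + 2 - 1 - 2 * ((n : ℝ) + 1) = a - 1 - 2 * n by ring,
      show 2 * ((n : ℝ) + 1) + (1 - (a + 2)) = 2 * n + (1 - a) by ring, pow_succ]
    ring
  simp_rw [this, tsum_neg]
  unfold tailCoeff
  simp only [pow_zero, Nat.cast_zero, mul_zero]
  rw [show a + 2 - 1 - 0 = a + 1 by ring, show 0 + (1 - (a + 2)) = -a - 1 by ring]
  ring

lemma tendsto_laplaceTail {a : ℝ} (ha : ∀ n : ℤ, a ≠ n) (h1 : a < 1) :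
    Tendsto (laplaceTail a) (𝓝[>] 0) (𝓝 0) :=
  (entireCoeff_tailCoeff ha).tendsto_zero (by linarith)

/-! ### The Laplace transform of `uᵃ / (1 + u²)` -/

lemma integrableOn_rpow_mul_exp {a s : ℝ} (ha : -1 < a) (hs : 0 < s) :
    IntegrableOn (fun u : ℝ => u ^ a * Real.exp (-(s * u))) (Ioi 0) := by
  simpa using integrableOn_rpow_mul_exp_neg_mul_rpow ha one_pos hs

lemma integral_rpow_mul_exp {a s : ℝ} (ha : -1 < a) (hs : 0 < s) :
    ∫ u in Ioi (0 : ℝ), u ^ a * Real.exp (-(s * u)) = Real.Gamma (a + 1) * s ^ (-a - 1) := by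
  have := Real.integral_rpow_mul_exp_neg_mul_Ioi (a := a + 1) (by linarith) hs
  rw [show a + 1 - 1 = a by ring] at this
  rw [this, one_div, ← Real.rpow_neg_eq_inv_rpow, mul_comm, neg_add']

/-- The Laplace transform of `uᵃ / (1 + u²)` at `s`. -/
noncomputable def laplaceInt (a s : ℝ) : ℝ :=
  ∫ u in Ioi (0 : ℝ), u ^ a * Real.exp (-(s * u)) / (1 + u ^ 2)

lemma abs_div_one_add_sq_le (x u : ℝ) : |x / (1 + u ^ 2)| ≤ |x| := by
  rw [abs_div, abs_of_pos (by positivity : 0 < 1 + u ^ 2)]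
  exact div_le_self (abs_nonneg _) (by nlinarith [sq_nonneg u])

lemma integrableOn_laplaceInt {a s : ℝ} (ha : -1 < a) (hs : 0 < s) :
    IntegrableOn (fun u : ℝ => u ^ a * Real.exp (-(s * u)) / (1 + u ^ 2)) (Ioi 0) := by
  refine Integrable.mono (integrableOn_rpow_mul_exp ha hs)
    (Measurable.aestronglyMeasurable (by fun_prop)) ?_
  exact Eventually.of_forall fun u => abs_div_one_add_sq_le _ u

/-- Comes from `u² / (1 + u²) = 1 - 1 / (1 + u²)`. -/
lemma laplaceInt_add_two {a s : ℝ} (ha : -1 < a) (hs : 0 < s) :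
    laplaceInt (a + 2) s + laplaceInt a s = Real.Gamma (a + 1) * s ^ (-a - 1) := by
  unfold laplaceInt
  rw [← integral_add (integrableOn_laplaceInt (by linarith) hs) (integrableOn_laplaceInt ha hs),
    ← integral_rpow_mul_exp ha hs]
  refine setIntegral_congr_fun measurableSet_Ioi fun u hu => ?_
  have hu0 : (0 : ℝ) < u := hu
  have : 1 + u ^ 2 ≠ 0 := by positivity
  rw [Real.rpow_add hu0, Real.rpow_two]
  field_simp
  ring

lemma hasDerivAt_laplaceInt {a s : ℝ} (ha : -1 < a) (hs : 0 < s) :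
    HasDerivAt (laplaceInt a) (-laplaceInt (a + 1) s) s := by
  have hs2 : 0 < s / 2 := by positivity
  have := (hasDerivAt_integral_of_dominated_loc_of_deriv_le (μ := volume.restrict (Ioi (0 : ℝ)))
    (F := fun s u : ℝ => u ^ a * Real.exp (-(s * u)) / (1 + u ^ 2))
    (F' := fun s u : ℝ => -(u ^ (a + 1) * Real.exp (-(s * u)) / (1 + u ^ 2)))
    (bound := fun u => u ^ (a + 1) * Real.exp (-((s / 2) * u)))
    (Ioi_mem_nhds (by linarith : s / 2 < s)) 
    (Eventually.of_forall fun x => Measurable.aestronglyMeasurable (by fun_prop))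
    (integrableOn_laplaceInt ha hs) (Measurable.aestronglyMeasurable (by fun_prop)) ?_
    (integrableOn_rpow_mul_exp (by linarith) hs2) ?_).2
  · rw [integral_neg] at this
    exact this
  · filter_upwards [ae_restrict_mem measurableSet_Ioi] with u hu x hx
    have hu0 : (0 : ℝ) < u := hu
    have hx' : s / 2 < x := hx
    rw [norm_neg]
    refine (abs_div_one_add_sq_le _ u).trans ?_
    rw [abs_of_nonneg (by positivity)]
    gcongr
  · filter_upwards [ae_restrict_mem measurableSet_Ioi] with u hu x hx
    have hu0 : (0 : ℝ) < u := hu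
    have h1 : HasDerivAt (fun x : ℝ => Real.exp (-(x * u))) (Real.exp (-(x * u)) * -(1 * u)) x :=
      (((hasDerivAt_id x).mul_const u).neg).exp
    refine ((h1.const_mul (u ^ a)).div_const (1 + u ^ 2)).congr_deriv ?_
    rw [Real.rpow_add hu0, Real.rpow_one]
    ring

/-- Swapping the two integrals in `∫∫ uᵃ exp (-v (1 + u²))` evaluates `∫ uᵃ / (1 + u²)`. -/
lemma integral_rpow_div_one_add_sq {a : ℝ} (ha : -1 < a) (ha1 : a < 1) :
    IntegrableOn (fun u : ℝ => u ^ a / (1 + u ^ 2)) (Ioi 0) ∧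
      ∫ u in Ioi (0 : ℝ), u ^ a / (1 + u ^ 2) = Real.pi / 2 / Real.cos (a * Real.pi / 2) := by
  set ν := volume.restrict (Ioi (0 : ℝ))
  set f : ℝ → ℝ → ℝ := fun u v => u ^ a * Real.exp (-((1 + u ^ 2) * v)) with hf
  have hsplit : ∀ v u : ℝ, f u v = Real.exp (-v) * (u ^ a * Real.exp (-v * u ^ (2 : ℝ))) := by
    intro v u
    rw [hf, Real.rpow_two]
    simp only
    rw [show -((1 + u ^ 2) * v) = -v + -v * u ^ 2 by ring, Real.exp_add]
    ring
  have hin : ∀ v : ℝ, 0 < v → ∫ u, f u v ∂ν =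
      Real.Gamma ((a + 1) / 2) / 2 * (v ^ (-(a + 1) / 2) * Real.exp (-(1 * v))) := by
    intro v hv
    simp_rw [hsplit v]
    rw [integral_const_mul, integral_rpow_mul_exp_neg_mul_rpow two_pos ha hv, one_mul]
    ring
  have hout : ∀ u : ℝ, 0 < u → ∫ v, f u v ∂ν = u ^ a / (1 + u ^ 2) := by
    intro u hu
    have h := integral_rpow_mul_exp (a := 0) (s := 1 + u ^ 2) (by norm_num) (by positivity)
    simp only [Real.rpow_zero, one_mul] at h
    simp only [hf]
    rw [integral_const_mul, h]
    norm_num [Real.rpow_neg_one]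
    rfl
  have hmeas : Measurable (Function.uncurry f) := by
    unfold Function.uncurry; fun_prop
  have hint : Integrable (Function.uncurry f) (ν.prod ν) := by
    rw [integrable_prod_iff' hmeas.aestronglyMeasurable]
    constructor
    · filter_upwards [ae_restrict_mem measurableSet_Ioi] with v hv
      simp only [Function.uncurry_apply_pair, hsplit v]
      exact (integrableOn_rpow_mul_exp_neg_mul_rpow ha two_pos hv).const_mul _
    · refine (((integrableOn_rpow_mul_exp (a := -(a + 1) / 2) (by linarith) one_pos).const_mul
        (Real.Gamma ((a + 1) / 2) / 2))).congr ?_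
      filter_upwards [ae_restrict_mem measurableSet_Ioi] with v hv
      rw [← hin v hv]
      refine setIntegral_congr_fun measurableSet_Ioi fun u hu => ?_
      have hu0 : (0 : ℝ) < u := hu
      simp only [Function.uncurry_apply_pair, hf]
      rw [Real.norm_of_nonneg (by positivity)]
  constructor
  · refine hint.integral_prod_left.congr ?_
    filter_upwards [ae_restrict_mem measurableSet_Ioi] with u hu
    exact hout u hu
  · have h1 : ∫ u in Ioi (0 : ℝ), u ^ a / (1 + u ^ 2) = ∫ u, ∫ v, f u v ∂ν ∂ν :=
      setIntegral_congr_fun measurableSet_Ioi fun u hu => (hout u hu).symm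
    have h2 : ∫ v, ∫ u, f u v ∂ν ∂ν = ∫ v in Ioi (0 : ℝ),
        Real.Gamma ((a + 1) / 2) / 2 * (v ^ (-(a + 1) / 2) * Real.exp (-(1 * v))) :=
      setIntegral_congr_fun measurableSet_Ioi fun v hv => hin v hv
    rw [h1, integral_integral_swap hint, h2, integral_const_mul,
      integral_rpow_mul_exp (by linarith) one_pos, Real.one_rpow, mul_one]
    have h3 := Real.Gamma_mul_Gamma_one_sub ((a + 1) / 2)
    rw [show Real.pi * ((a + 1) / 2) = a * Real.pi / 2 + Real.pi / 2 by ring,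
      Real.sin_add_pi_div_two] at h3
    rw [show -(a + 1) / 2 + 1 = 1 - (a + 1) / 2 by ring, div_mul_eq_mul_div, h3]
    ring

lemma tendsto_laplaceInt {a : ℝ} (ha : -1 < a) (ha1 : a < 1) :
    Tendsto (laplaceInt a) (𝓝[>] 0) (𝓝 (Real.pi / 2 / Real.cos (a * Real.pi / 2))) := by
  obtain ⟨hi, hv⟩ := integral_rpow_div_one_add_sq ha ha1
  rw [← hv]
  refine tendsto_integral_filter_of_dominated_convergence _
    (Eventually.of_forall fun s => Measurable.aestronglyMeasurable (by fun_prop)) ?_ hi ?_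
  · filter_upwards [self_mem_nhdsWithin] with s hs
    filter_upwards [ae_restrict_mem measurableSet_Ioi] with u hu
    have hu0 : (0 : ℝ) < u := hu
    have hs0 : (0 : ℝ) < s := hs
    rw [Real.norm_of_nonneg (by positivity)]
    gcongr
    exact mul_le_of_le_one_right (by positivity) (Real.exp_le_one_iff.2 (by nlinarith))
  · refine Eventually.of_forall fun u => ?_
    have : Continuous fun s : ℝ => u ^ a * Real.exp (-(s * u)) / (1 + u ^ 2) := by fun_prop
    have := (this.tendsto 0).mono_left (nhdsWithin_le_nhds (s := Ioi (0 : ℝ)))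
    simpa using this

/-- The trigonometric part of `laplaceInt`. -/
noncomputable def laplaceTrig (a s : ℝ) : ℝ :=
  Real.pi / 2 / Real.cos (a * Real.pi / 2) * Real.cos s +
    Real.pi / 2 / Real.sin (a * Real.pi / 2) * Real.sin s

lemma laplaceTrig_add_one (a s : ℝ) : laplaceTrig (a + 1) s =
    -(Real.pi / 2 / Real.sin (a * Real.pi / 2)) * Real.cos s +
    Real.pi / 2 / Real.cos (a * Real.pi / 2) * Real.sin s := by
  unfold laplaceTrig
  rw [show (a + 1) * Real.pi / 2 = a * Real.pi / 2 + Real.pi / 2 by ring,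
    Real.sin_add_pi_div_two, Real.cos_add_pi_div_two, div_neg]

lemma laplaceTrig_add_two (a s : ℝ) : laplaceTrig (a + 2) s = -laplaceTrig a s := by
  rw [show a + 2 = a + 1 + 1 by ring, laplaceTrig_add_one, laplaceTrig,
    show (a + 1) * Real.pi / 2 = a * Real.pi / 2 + Real.pi / 2 by ring,
    Real.sin_add_pi_div_two, Real.cos_add_pi_div_two, div_neg]
  ring

lemma hasDerivAt_laplaceTrig (a s : ℝ) :
    HasDerivAt (laplaceTrig a) (-laplaceTrig (a + 1) s) s := by
  refine (((Real.hasDerivAt_cos s).const_mul _).add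
    ((Real.hasDerivAt_sin s).const_mul _)).congr_deriv ?_
  rw [laplaceTrig_add_one]
  ring

lemma tendsto_laplaceTrig (a : ℝ) :
    Tendsto (laplaceTrig a) (𝓝[>] 0) (𝓝 (Real.pi / 2 / Real.cos (a * Real.pi / 2))) := by
  have : Continuous (laplaceTrig a) := by unfold laplaceTrig; fun_prop
  have h := (this.tendsto 0).mono_left (nhdsWithin_le_nhds (s := Ioi (0 : ℝ)))
  simpa [laplaceTrig] using h

/-- A function with zero derivative on `(0, ∞)` is equal to its limit at `0`. -/
lemma eq_of_hasDerivAt_zero_of_tendsto {f : ℝ → ℝ} {l : ℝ}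
    (hf : ∀ s, 0 < s → HasDerivAt f 0 s) (hl : Tendsto f (𝓝[>] 0) (𝓝 l)) {s : ℝ} (hs : 0 < s) :
    f s = l := by
  obtain ⟨c, hc⟩ := isOpen_Ioi.exists_is_const_of_deriv_eq_zero (s := Ioi (0 : ℝ))
    isPreconnected_Ioi (f := f)
    (fun x hx => (hf x hx).differentiableAt.differentiableWithinAt)
    (fun x hx => (hf x hx).deriv)
  have : Tendsto f (𝓝[>] 0) (𝓝 c) :=
    tendsto_const_nhds.congr' (by filter_upwards [self_mem_nhdsWithin] with x hx using (hc x hx).symm)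
  rw [hc s hs]
  exact tendsto_nhds_unique this hl

/-- The difference `E a` between the Laplace transform and its claimed value satisfies
`E a' = -E (a+1)` and `E (a+2) = -E a`, so `E a ^ 2 + E (a+1) ^ 2` is constant. It tends to zero
at the origin when both `a` and `a + 1` lie in `(-1, 1)`. -/
lemma laplaceInt_eq_of_neg {a s : ℝ} (ha : -1 < a) (ha0 : a < 0) (hs : 0 < s) :
    laplaceInt a s = laplaceTrig a s + laplaceTail a s ∧
      laplaceInt (a + 1) s = laplaceTrig (a + 1) s + laplaceTail (a + 1) s := by
  have hn : ∀ n : ℤ, a ≠ n := by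
    intro n h
    have h1 : (-1 : ℝ) < n := h ▸ ha
    have h2 : (n : ℝ) < 0 := h ▸ ha0
    have h3 : (-1 : ℤ) < n := by exact_mod_cast h1
    have h4 : n < (0 : ℤ) := by exact_mod_cast h2
    omega
  have hn1 : ∀ n : ℤ, a + 1 ≠ n := by simpa using not_int_add hn 1
  set E : ℝ → ℝ → ℝ := fun a s => laplaceInt a s - (laplaceTrig a s + laplaceTail a s) with hE
  have hE1 : ∀ x, 0 < x → HasDerivAt (E a) (-E (a + 1) x) x := fun x hx =>
    ((hasDerivAt_laplaceInt ha hx).sub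
      ((hasDerivAt_laplaceTrig a x).add (hasDerivAt_laplaceTail hn hx))).congr_deriv
      (by simp only [hE]; ring)
  have hE2 : ∀ x, 0 < x → HasDerivAt (E (a + 1)) (E a x) x := fun x hx =>
    ((hasDerivAt_laplaceInt (by linarith) hx).sub
      ((hasDerivAt_laplaceTrig (a + 1) x).add (hasDerivAt_laplaceTail hn1 hx))).congr_deriv (by
        have h1 := laplaceInt_add_two ha hx
        have h2 := laplaceTail_add_two hn hx
        have h3 := laplaceTrig_add_two a x
        simp only [hE]
        rw [show a + 1 + 1 = a + 2 by ring]
        linarith)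
  have hlim : ∀ c : ℝ, -1 < c → c < 1 → (∀ n : ℤ, c ≠ n) → Tendsto (E c) (𝓝[>] 0) (𝓝 0) := by
    intro c h1 h2 h3
    simpa using (tendsto_laplaceInt h1 h2).sub ((tendsto_laplaceTrig c).add
      (tendsto_laplaceTail h3 h2))
  have hzero : E a s ^ 2 + E (a + 1) s ^ 2 = 0 := by
    refine eq_of_hasDerivAt_zero_of_tendsto (f := fun s => E a s ^ 2 + E (a + 1) s ^ 2)
      (fun x hx => ?_) ?_ hs
    · refine (((hE1 x hx).pow 2).add ((hE2 x hx).pow 2)).congr_deriv ?_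
      push_cast
      ring
    · simpa using ((hlim a ha (by linarith) hn).pow 2).add
        ((hlim (a + 1) (by linarith) (by linarith) hn1).pow 2)
  have h1 : E a s = 0 := by nlinarith [sq_nonneg (E a s), sq_nonneg (E (a + 1) s)]
  have h2 : E (a + 1) s = 0 := by nlinarith [sq_nonneg (E a s), sq_nonneg (E (a + 1) s)]
  exact ⟨sub_eq_zero.1 h1, sub_eq_zero.1 h2⟩

/-- The Laplace transform of `uᵃ / (1 + u²)` in closed form: the case `a < 1` and the recursion
`a ↦ a + 2`. -/
theorem laplaceInt_eq {a s : ℝ} (ha : -1 < a) (hn : ∀ n : ℤ, a ≠ n) (hs : 0 < s) :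
    laplaceInt a s = laplaceTrig a s + laplaceTail a s := by
  obtain ⟨k, hk⟩ := exists_nat_gt ((a - 1) / 2)
  have hk' : a < 2 * k + 1 := by linarith
  clear hk
  induction k generalizing a with
  | zero =>
    have h0 := hn 0
    simp only [Int.cast_zero, CharP.cast_eq_zero, mul_zero, zero_add] at h0 hk'
    rcases lt_or_gt_of_ne h0 with h | h
    · exact (laplaceInt_eq_of_neg ha h hs).1
    · have := (laplaceInt_eq_of_neg (a := a - 1) (by linarith) (by linarith) hs).2
      rwa [sub_add_cancel] at this
  | succ k ih =>
    push_cast at hk'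
    by_cases h : a < 2 * k + 1
    · exact ih ha hn h
    · have hk0 : (0 : ℝ) ≤ k := k.cast_nonneg
      have ha1 : a ≠ 1 := by simpa using hn 1
      have ha2 : 1 < a := lt_of_le_of_ne (by linarith) ha1.symm
      have hn2 : ∀ n : ℤ, a - 2 ≠ n := by
        have := not_int_add hn (-2)
        push_cast at this
        simpa [sub_eq_add_neg] using this
      have h1 := ih (a := a - 2) (by linarith) hn2 (by linarith)
      have h2 := laplaceInt_add_two (a := a - 2) (by linarith) hs
      have h3 := laplaceTail_add_two hn2 hs
      have h4 := laplaceTrig_add_two (a - 2) s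
      rw [sub_add_cancel] at h2 h3 h4
      linarith

/-! ### Logarithmic moments of the Gamma density -/

lemma abs_log_le {ε t : ℝ} (hε : 0 < ε) (ht : 0 < t) : |Real.log t| ≤ t ^ (-ε) / ε + t := by
  have h1 := Real.log_le_sub_one_of_pos ht
  have h2 := Real.log_le_rpow_div (inv_nonneg.2 ht.le) hε
  rw [Real.log_inv, Real.inv_rpow ht.le, ← Real.rpow_neg ht.le] at h2
  have h3 : 0 ≤ t ^ (-ε) / ε := by positivity
  rw [abs_le]
  constructor <;> linarith

lemma integrableOn_rpow_mul_exp_neg {a : ℝ} (ha : -1 < a) :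
    IntegrableOn (fun t : ℝ => t ^ a * Real.exp (-t)) (Ioi 0) := by
  simpa using integrableOn_rpow_mul_exp ha one_pos

lemma integral_rpow_mul_exp_neg {a : ℝ} (ha : -1 < a) :
    ∫ t in Ioi (0 : ℝ), t ^ a * Real.exp (-t) = Real.Gamma (a + 1) := by
  simpa using integral_rpow_mul_exp ha one_pos

lemma integrableOn_rpow_mul_exp_mul_log {a : ℝ} (ha : -1 < a) :
    IntegrableOn (fun t : ℝ => t ^ a * Real.exp (-t) * Real.log t) (Ioi 0) := by
  -- `ε` leaves the exponent `a - ε` above `-1`.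
  set ε : ℝ := (a + 1) / 2 with hε
  have hε0 : 0 < ε := by linarith
  refine Integrable.mono' (g := fun t : ℝ => t ^ (a - ε) * Real.exp (-t) / ε +
      t ^ (a + 1) * Real.exp (-t))
    (((integrableOn_rpow_mul_exp_neg (by linarith)).div_const ε).add
      (integrableOn_rpow_mul_exp_neg (by linarith)))
    (Measurable.aestronglyMeasurable (by fun_prop)) ?_
  filter_upwards [ae_restrict_mem measurableSet_Ioi] with t ht
  have ht0 : (0 : ℝ) < t := ht
  rw [norm_mul, Real.norm_of_nonneg (by positivity), Real.norm_eq_abs]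
  calc t ^ a * Real.exp (-t) * |Real.log t| ≤ t ^ a * Real.exp (-t) * (t ^ (-ε) / ε + t) := by
        gcongr
        exact abs_log_le hε0 ht0
    _ = _ := by
        rw [sub_eq_add_neg, Real.rpow_add ht0, Real.rpow_add ht0, Real.rpow_one]
        ring

lemma deriv_Gamma_eq_integral {a : ℝ} (ha : -1 < a) :
    deriv Real.Gamma (a + 1) = ∫ t in Ioi (0 : ℝ), t ^ a * Real.exp (-t) * Real.log t := by
  have h0 : 0 < ((a + 1 : ℝ) : ℂ).re := by rw [Complex.ofReal_re]; linarith
  have h1 := Complex.hasDerivAt_GammaIntegral h0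
  have h2 : HasDerivAt Complex.Gamma _ ((a + 1 : ℝ) : ℂ) := h1.congr_of_eventuallyEq (by
    have : IsOpen {s : ℂ | 0 < s.re} := Complex.continuous_re.isOpen_preimage _ isOpen_Ioi
    filter_upwards [this.mem_nhds h0] with s hs using Complex.Gamma_eq_integral hs)
  have h3 := h2.real_of_complex
  have h4 : deriv Real.Gamma (a + 1) = _ := h3.deriv
  rw [h4, ← Complex.ofReal_inj, ← integral_complex_ofReal]
  have h5 : ∫ t : ℝ in Ioi 0, (t : ℂ) ^ (((a + 1 : ℝ) : ℂ) - 1) *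
      ((Real.log t : ℂ) * (Real.exp (-t) : ℂ)) =
      ∫ t in Ioi (0 : ℝ), ((t ^ a * Real.exp (-t) * Real.log t : ℝ) : ℂ) := by
    refine setIntegral_congr_fun measurableSet_Ioi fun t ht => ?_
    have ht0 : (0 : ℝ) ≤ t := le_of_lt ht
    simp only [Complex.ofReal_mul, Complex.ofReal_cpow ht0]
    push_cast
    rw [add_sub_cancel_right]
    ring
  rw [h5, integral_complex_ofReal, Complex.ofReal_re]

/-- The logarithmic moment `∫ tᵃ e⁻ᵗ log (s² + t²)`. -/
noncomputable def logMoment (a s : ℝ) : ℝ :=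
  ∫ t in Ioi (0 : ℝ), t ^ a * Real.exp (-t) * Real.log (s ^ 2 + t ^ 2)

lemma abs_log_sq_add_sq_le {s t : ℝ} (hs : 0 ≤ s) (hs1 : s ≤ 1) (ht : 0 < t) :
    |Real.log (s ^ 2 + t ^ 2)| ≤ 2 * |Real.log t| + t ^ 2 := by
  have h1 : Real.log (s ^ 2 + t ^ 2) ≤ t ^ 2 := by
    have := Real.log_le_sub_one_of_pos (by positivity : 0 < s ^ 2 + t ^ 2)
    nlinarith
  have h2 : 2 * Real.log t ≤ Real.log (s ^ 2 + t ^ 2) := by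
    have := Real.log_le_log (by positivity : 0 < t ^ 2)
      (by nlinarith [sq_nonneg s] : t ^ 2 ≤ s ^ 2 + t ^ 2)
    rwa [Real.log_pow, Nat.cast_ofNat] at this
  have h3 := neg_abs_le (Real.log t)
  rw [abs_le]
  constructor <;> nlinarith [abs_nonneg (Real.log t), sq_nonneg t]

/-- The boundary value at `s = 0` is the source of the digamma term. -/
lemma tendsto_logMoment {a : ℝ} (ha : -1 < a) :
    Tendsto (logMoment a) (𝓝[>] 0) (𝓝 (2 * deriv Real.Gamma (a + 1))) := by
  rw [deriv_Gamma_eq_integral ha, ← integral_const_mul]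
  refine tendsto_integral_filter_of_dominated_convergence
    (fun t : ℝ => 2 * ‖t ^ a * Real.exp (-t) * Real.log t‖ + t ^ (a + 2) * Real.exp (-t))
    (Eventually.of_forall fun s => Measurable.aestronglyMeasurable (by fun_prop)) ?_
    (((integrableOn_rpow_mul_exp_mul_log ha).norm.const_mul 2).add
      (integrableOn_rpow_mul_exp_neg (by linarith))) ?_
  · filter_upwards [Ioo_mem_nhdsGT (zero_lt_one' ℝ)] with s hs
    filter_upwards [ae_restrict_mem measurableSet_Ioi] with t ht
    have ht0 : (0 : ℝ) < t := ht
    have h := abs_log_sq_add_sq_le hs.1.le hs.2.le ht0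
    have hw : 0 ≤ t ^ a * Real.exp (-t) := by positivity
    rw [norm_mul _ (Real.log (s ^ 2 + t ^ 2)), norm_mul _ (Real.log t), Real.norm_of_nonneg hw,
      Real.norm_eq_abs, Real.norm_eq_abs,
      Real.rpow_add ht0, Real.rpow_two]
    calc _ ≤ t ^ a * Real.exp (-t) * (2 * |Real.log t| + t ^ 2) := by gcongr
      _ = _ := by ring
  · filter_upwards [ae_restrict_mem measurableSet_Ioi] with t ht
    have ht0 : (0 : ℝ) < t := ht
    have hc : ContinuousAt (fun s : ℝ => t ^ a * Real.exp (-t) * Real.log (s ^ 2 + t ^ 2)) 0 := by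
      refine ContinuousAt.mul (by fun_prop) (ContinuousAt.log (by fun_prop) (by positivity))
    have h := hc.tendsto.mono_left (nhdsWithin_le_nhds (s := Ioi (0 : ℝ)))
    convert h using 2
    rw [zero_pow two_ne_zero, zero_add, Real.log_pow]
    push_cast
    ring

lemma integrableOn_log_one_add {a κ : ℝ} (ha : -1 < a) (hκ : 0 < κ) :
    IntegrableOn (fun t : ℝ => t ^ a * Real.exp (-t) * Real.log (1 + κ * t ^ 2)) (Ioi 0) := by
  refine Integrable.mono' ((integrableOn_rpow_mul_exp_neg (a := a + 2) (by linarith)).const_mul κ)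
    (Measurable.aestronglyMeasurable (by fun_prop)) ?_
  filter_upwards [ae_restrict_mem measurableSet_Ioi] with t ht
  have ht0 : (0 : ℝ) < t := ht
  have h1 : 0 ≤ Real.log (1 + κ * t ^ 2) := Real.log_nonneg (by nlinarith [mul_pos hκ (pow_pos ht0 2)])
  have h2 : Real.log (1 + κ * t ^ 2) ≤ κ * t ^ 2 := by
    have := Real.log_le_sub_one_of_pos (by positivity : 0 < 1 + κ * t ^ 2)
    linarith
  rw [Real.norm_of_nonneg (by positivity), Real.rpow_add ht0, Real.rpow_two]
  calc _ ≤ t ^ a * Real.exp (-t) * (κ * t ^ 2) := by gcongr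
    _ = _ := by ring

lemma rpow_mul_exp_mul_log_sq_add_sq {a s t : ℝ} (hs : 0 < s) :
    t ^ a * Real.exp (-t) * Real.log (s ^ 2 + t ^ 2) =
      t ^ a * Real.exp (-t) * Real.log (1 + (s ^ 2)⁻¹ * t ^ 2) +
        2 * Real.log s * (t ^ a * Real.exp (-t)) := by
  rw [show s ^ 2 + t ^ 2 = s ^ 2 * (1 + (s ^ 2)⁻¹ * t ^ 2) by field_simp,
    Real.log_mul (by positivity) (by positivity), Real.log_pow]
  push_cast
  ring

lemma integrableOn_logMoment {a s : ℝ} (ha : -1 < a) (hs : 0 < s) :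
    IntegrableOn (fun t : ℝ => t ^ a * Real.exp (-t) * Real.log (s ^ 2 + t ^ 2)) (Ioi 0) := by
  simp_rw [rpow_mul_exp_mul_log_sq_add_sq hs]
  exact (integrableOn_log_one_add ha (by positivity)).add
    ((integrableOn_rpow_mul_exp_neg ha).const_mul _)

lemma integral_log_one_add {a s : ℝ} (ha : -1 < a) (hs : 0 < s) :
    ∫ t in Ioi (0 : ℝ), t ^ a * Real.exp (-t) * Real.log (1 + (s ^ 2)⁻¹ * t ^ 2) =
      logMoment a s - 2 * Real.log s * Real.Gamma (a + 1) := by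
  unfold logMoment
  simp_rw [rpow_mul_exp_mul_log_sq_add_sq hs]
  rw [integral_add (integrableOn_log_one_add ha (by positivity))
    ((integrableOn_rpow_mul_exp_neg ha).const_mul _), integral_const_mul,
    integral_rpow_mul_exp_neg ha]
  ring

lemma hasDerivAt_logMoment {a s : ℝ} (ha : -1 < a) (hs : 0 < s) :
    HasDerivAt (logMoment a) (2 * (s ^ a * laplaceInt a s)) s := by
  have h := (hasDerivAt_integral_of_dominated_loc_of_deriv_le (μ := volume.restrict (Ioi (0 : ℝ)))
    (F := fun s t : ℝ => t ^ a * Real.exp (-t) * Real.log (s ^ 2 + t ^ 2))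
    (F' := fun s t : ℝ => t ^ a * Real.exp (-t) * (2 * s / (s ^ 2 + t ^ 2)))
    (bound := fun t : ℝ => t ^ a * Real.exp (-t) * (2 * (2 * s) / (s / 2) ^ 2))
    (Ioo_mem_nhds (by linarith : s / 2 < s) (by linarith : s < 2 * s))
    (Eventually.of_forall fun x => Measurable.aestronglyMeasurable (by fun_prop))
    (integrableOn_logMoment ha hs) (Measurable.aestronglyMeasurable (by fun_prop)) ?_
    ((integrableOn_rpow_mul_exp_neg ha).mul_const _) ?_).2
  · refine h.congr_deriv ?_
    -- The substitution `t = s u` turns the derivative into `laplaceInt`.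
    have hsc := integral_comp_mul_left_Ioi
      (fun t : ℝ => t ^ a * Real.exp (-t) * (2 * s / (s ^ 2 + t ^ 2))) 0 hs
    rw [mul_zero, smul_eq_mul, eq_comm, inv_mul_eq_iff_eq_mul₀ hs.ne'] at hsc
    rw [hsc, laplaceInt, ← integral_const_mul, ← integral_const_mul, ← integral_const_mul]
    refine setIntegral_congr_fun measurableSet_Ioi fun u hu => ?_
    have hu0 : (0 : ℝ) < u := hu
    have h1 : 1 + u ^ 2 ≠ 0 := by positivity
    have h2 : s ^ 2 + (s * u) ^ 2 = s ^ 2 * (1 + u ^ 2) := by ring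
    rw [Real.mul_rpow hs.le hu0.le, h2]
    field_simp
  · filter_upwards [ae_restrict_mem measurableSet_Ioi] with t ht x hx
    have ht0 : (0 : ℝ) < t := ht
    have hx0 : 0 < x := by linarith [hx.1]
    rw [Real.norm_of_nonneg (by positivity)]
    gcongr
    · exact hx.2.le
    · have : (s / 2) ^ 2 ≤ x ^ 2 := by gcongr; exact hx.1.le
      nlinarith [sq_nonneg t]
  · filter_upwards [ae_restrict_mem measurableSet_Ioi] with t ht x hx
    have ht0 : (0 : ℝ) < t := ht
    have hx0 : 0 < x := by linarith [hx.1]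
    have h1 : HasDerivAt (fun x : ℝ => x ^ 2 + t ^ 2) (2 * x) x := by
      simpa using (hasDerivAt_pow 2 x).add_const (t ^ 2)
    exact (h1.log (by positivity)).const_mul _

/-! ### The logarithmic moment as a series -/

/-- Coefficients of the primitive of `sᵃ cos s` that vanishes at `0`, as a series in `s^(2n+a+1)`. -/
noncomputable def cosCoeff (a : ℝ) (n : ℕ) : ℝ :=
  (-1) ^ n / ((2 * n).factorial * (2 * (n : ℝ) + (a + 1)))

/-- Coefficients of the primitive of `sᵃ sin s` that vanishes at `0`, as a series in `s^(2n+a+2)`. -/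
noncomputable def sinCoeff (a : ℝ) (n : ℕ) : ℝ :=
  (-1) ^ n / ((2 * n + 1).factorial * (2 * (n : ℝ) + (a + 2)))

lemma entireCoeff_inv_factorial : EntireCoeff fun n => ((n.factorial : ℝ))⁻¹ := by
  intro R _
  refine (Real.summable_pow_div_factorial R).congr fun n => ?_
  rw [abs_of_nonneg (by positivity)]
  ring

lemma entireCoeff_of_factorial {k : ℕ → ℕ} (hk : ∀ n, n ≤ k n) {p : ℝ} (hp : 0 < p) :
    EntireCoeff fun n => (-1) ^ n / ((k n).factorial * (2 * (n : ℝ) + p)) := by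
  refine entireCoeff_inv_factorial.of_abs_le (K := p⁻¹) fun n => ?_
  have h1 : (n.factorial : ℝ) ≤ (k n).factorial := by exact_mod_cast Nat.factorial_le (hk n)
  have h2 : (0 : ℝ) < n.factorial := by positivity
  have h3 : (0 : ℝ) ≤ n := n.cast_nonneg
  rw [abs_div, abs_pow, abs_neg, abs_one, one_pow,
    abs_of_pos (by positivity : 0 < ((k n).factorial : ℝ) * (2 * (n : ℝ) + p)),
    abs_of_pos (by positivity : 0 < (n.factorial : ℝ)⁻¹), one_div, ← mul_inv, mul_comm p]
  gcongr
  linarith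

lemma entireCoeff_cosCoeff {a : ℝ} (ha : -1 < a) : EntireCoeff (cosCoeff a) :=
  entireCoeff_of_factorial (k := fun n => 2 * n) (fun n => by omega) (by linarith)

lemma entireCoeff_sinCoeff {a : ℝ} (ha : -1 < a) : EntireCoeff (sinCoeff a) :=
  entireCoeff_of_factorial (k := fun n => 2 * n + 1) (fun n => by omega) (by linarith)

lemma hasDerivAt_cosSeries {a s : ℝ} (ha : -1 < a) (hs : 0 < s) :
    HasDerivAt (evenSeries (cosCoeff a) (a + 1)) (s ^ a * Real.cos s) s := by
  refine ((entireCoeff_cosCoeff ha).hasDerivAt (a + 1) hs).congr_deriv ?_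
  unfold evenSeries
  rw [Real.cos_eq_tsum, ← tsum_mul_left]
  refine tsum_congr fun n => ?_
  have h : 2 * (n : ℝ) + (a + 1) ≠ 0 := by
    have : (0 : ℝ) ≤ n := n.cast_nonneg
    intro h; linarith
  rw [add_sub_cancel_right, rpow_two_mul_add hs, pow_mul]
  simp only [cosCoeff]
  field_simp

lemma hasDerivAt_sinSeries {a s : ℝ} (ha : -1 < a) (hs : 0 < s) :
    HasDerivAt (evenSeries (sinCoeff a) (a + 2)) (s ^ a * Real.sin s) s := by
  refine ((entireCoeff_sinCoeff ha).hasDerivAt (a + 2) hs).congr_deriv ?_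
  unfold evenSeries
  rw [Real.sin_eq_tsum, ← tsum_mul_left]
  refine tsum_congr fun n => ?_
  have h : 2 * (n : ℝ) + (a + 2) ≠ 0 := by
    have : (0 : ℝ) ≤ n := n.cast_nonneg
    intro h; linarith
  rw [show a + 2 - 1 = a + 1 by ring, rpow_two_mul_add hs, pow_succ s (2 * n), pow_mul,
    Real.rpow_add hs, Real.rpow_one]
  simp only [sinCoeff]
  field_simp

lemma entireCoeff_tailCoeff_div {a : ℝ} (hn : ∀ n : ℤ, a ≠ n) :
    EntireCoeff fun n => tailCoeff a n / ((n : ℝ) + 1) := by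
  refine (entireCoeff_tailCoeff hn).of_abs_le (K := 1) fun n => ?_
  rw [abs_div, one_mul, abs_of_pos (by positivity : (0 : ℝ) < n + 1)]
  exact div_le_self (abs_nonneg _) (by linarith [(n.cast_nonneg : (0 : ℝ) ≤ n)])

lemma hasDerivAt_tailSeries {a s : ℝ} (hn : ∀ n : ℤ, a ≠ n) (hs : 0 < s) :
    HasDerivAt (evenSeries (fun n => tailCoeff a n / ((n : ℝ) + 1)) 2)
      (2 * (s ^ a * laplaceTail a s)) s := by
  refine ((entireCoeff_tailCoeff_div hn).hasDerivAt 2 hs).congr_deriv ?_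
  unfold laplaceTail evenSeries
  rw [← tsum_mul_left, ← tsum_mul_left]
  refine tsum_congr fun n => ?_
  have h : (n : ℝ) + 1 ≠ 0 := by positivity
  have h1 : s ^ a * s ^ (1 - a) = s := by
    rw [← Real.rpow_add hs]; simp
  rw [rpow_two_mul_add hs, rpow_two_mul_add hs, show (2 : ℝ) - 1 = 1 by norm_num, Real.rpow_one,
    show 2 * (s ^ a * (tailCoeff a n * ((s ^ 2) ^ n * s ^ (1 - a)))) =
      2 * (tailCoeff a n * (s ^ 2) ^ n) * (s ^ a * s ^ (1 - a)) by ring, h1]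
  field_simp

/-- The series for the logarithmic moment: both sides have the same derivative in `s` and the same
limit at `s = 0`. -/
theorem logMoment_eq {a s : ℝ} (ha : -1 < a) (hn : ∀ n : ℤ, a ≠ n) (hs : 0 < s) :
    logMoment a s = 2 * deriv Real.Gamma (a + 1) +
      (Real.pi / Real.cos (a * Real.pi / 2) * evenSeries (cosCoeff a) (a + 1) s +
        Real.pi / Real.sin (a * Real.pi / 2) * evenSeries (sinCoeff a) (a + 2) s +
        evenSeries (fun n => tailCoeff a n / ((n : ℝ) + 1)) 2 s) := by
  rw [← sub_eq_iff_eq_add]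
  refine eq_of_hasDerivAt_zero_of_tendsto (f := fun s => logMoment a s -
    (Real.pi / Real.cos (a * Real.pi / 2) * evenSeries (cosCoeff a) (a + 1) s +
        Real.pi / Real.sin (a * Real.pi / 2) * evenSeries (sinCoeff a) (a + 2) s +
        evenSeries (fun n => tailCoeff a n / ((n : ℝ) + 1)) 2 s)) (fun x hx => ?_) ?_ hs
  · refine ((hasDerivAt_logMoment ha hx).sub ((((hasDerivAt_cosSeries ha hx).const_mul _).add
      ((hasDerivAt_sinSeries ha hx).const_mul _)).add (hasDerivAt_tailSeries hn hx))).congr_deriv ?_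
    rw [laplaceInt_eq ha hn hx, laplaceTrig]
    ring
  · have h1 := ((entireCoeff_cosCoeff ha).tendsto_zero (p := a + 1) (by linarith)).const_mul
      (Real.pi / Real.cos (a * Real.pi / 2))
    have h2 := ((entireCoeff_sinCoeff ha).tendsto_zero (p := a + 2) (by linarith)).const_mul
      (Real.pi / Real.sin (a * Real.pi / 2))
    have h3 := (entireCoeff_tailCoeff_div hn).tendsto_zero two_pos
    simpa using (tendsto_logMoment ha).sub ((h1.add h2).add h3)

/-! ### The hypergeometric functions of the closed forms as series -/

lemma ascPochhammer_eval_mul_add (x : ℝ) (n : ℕ) :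
    (ascPochhammer ℝ n).eval x * (x + n) = x * (ascPochhammer ℝ n).eval (x + 1) := by
  induction n with
  | zero => simp
  | succ n ih =>
    rw [ascPochhammer_succ_eval, ascPochhammer_succ_eval, ih]
    push_cast
    ring

lemma ascPochhammer_eval_half (n : ℕ) :
    (ascPochhammer ℝ n).eval (1 / 2) * n.factorial * 4 ^ n = (2 * n).factorial := by
  induction n with
  | zero => simp
  | succ n ih =>
    rw [show 2 * (n + 1) = 2 * n + 1 + 1 by ring, Nat.factorial_succ, Nat.factorial_succ,
      Nat.factorial_succ, ascPochhammer_succ_eval]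
    push_cast
    rw [← ih]
    ring

lemma ascPochhammer_eval_three_halves (n : ℕ) :
    (ascPochhammer ℝ n).eval (3 / 2) * n.factorial * 4 ^ n = (2 * n + 1).factorial := by
  induction n with
  | zero => simp
  | succ n ih =>
    rw [show 2 * (n + 1) + 1 = 2 * n + 1 + 1 + 1 by ring, Nat.factorial_succ (2 * n + 1 + 1),
      Nat.factorial_succ (2 * n + 1), Nat.factorial_succ n, ascPochhammer_succ_eval]
    push_cast
    rw [← ih]
    ring

lemma ascPochhammer_eval_two (n : ℕ) :
    (ascPochhammer ℝ n).eval 2 = (n + 1).factorial := by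
  induction n with
  | zero => simp
  | succ n ih =>
    rw [Nat.factorial_succ, ascPochhammer_succ_eval, ih]
    push_cast
    ring

/-- Legendre duplication of Pochhammer symbols, combined with the recursion of `Γ`. -/
lemma ascPochhammer_mul_Gamma {a : ℝ} (ha : ∀ n : ℤ, a ≠ n) (n : ℕ) :
    (ascPochhammer ℝ n).eval (1 - a / 2) * (ascPochhammer ℝ n).eval ((3 - a) / 2) * 4 ^ n *
      Real.Gamma (a - 1 - 2 * n) = Real.Gamma (a - 1) := by
  induction n with
  | zero => simp
  | succ n ih =>
    have h1 : a - 2 - 2 * n ≠ 0 := fun h => ha (2 + 2 * n) (by push_cast; linarith)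
    have h2 : a - 3 - 2 * n ≠ 0 := fun h => ha (3 + 2 * n) (by push_cast; linarith)
    rw [show a - 1 - 2 * (n : ℝ) = (a - 2 - 2 * n) + 1 by ring, Real.Gamma_add_one h1,
      show a - 2 - 2 * (n : ℝ) = (a - 3 - 2 * n) + 1 by ring, Real.Gamma_add_one h2] at ih
    rw [← ih, ascPochhammer_succ_eval, ascPochhammer_succ_eval]
    push_cast
    rw [show a - 1 - 2 * ((n : ℝ) + 1) = a - 3 - 2 * n by ring]
    ring

lemma ascPochhammer_eval_ne_zero {x : ℝ} (hx : ∀ n : ℕ, x + n ≠ 0) (n : ℕ) :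
    (ascPochhammer ℝ n).eval x ≠ 0 := by
  induction n with
  | zero => simp
  | succ n ih => rw [ascPochhammer_succ_eval]; exact mul_ne_zero ih (hx n)

lemma neg_div_four_pow (s : ℝ) (n : ℕ) : (-(s ^ 2) / 4) ^ n = (-1) ^ n * (s ^ 2) ^ n / 4 ^ n := by
  rw [div_pow, neg_pow]

lemma sinSeries_eq_pFq {a s : ℝ} (ha : -1 < a) (hs : 0 < s) :
    evenSeries (sinCoeff a) (a + 2) s =
      s ^ (a + 2) * pFq [1 + a / 2] [3 / 2, 2 + a / 2] (-(s ^ 2) / 4) / (a + 2) := by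
  unfold evenSeries pFq
  rw [mul_div_assoc, ← tsum_div_const, ← tsum_mul_left]
  refine tsum_congr fun n => ?_
  have hn : (0 : ℝ) ≤ n := n.cast_nonneg
  have h1 := ascPochhammer_eval_mul_add (1 + a / 2) n
  rw [show 1 + a / 2 + 1 = 2 + a / 2 by ring] at h1
  have h2 : (ascPochhammer ℝ n).eval (2 + a / 2) ≠ 0 := (ascPochhammer_pos n _ (by linarith)).ne'
  have h3 : (ascPochhammer ℝ n).eval (3 / 2 : ℝ) ≠ 0 := (ascPochhammer_pos n _ (by norm_num)).ne'
  have h4 : 2 * (n : ℝ) + (a + 2) ≠ 0 := by intro h; linarith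
  have h5 : a + 2 ≠ 0 := by intro h; linarith
  have h6 : (ascPochhammer ℝ n).eval (1 + a / 2) / (ascPochhammer ℝ n).eval (2 + a / 2) =
      (a + 2) / (2 * (n : ℝ) + (a + 2)) := by
    rw [div_eq_div_iff h2 h4]
    linear_combination 2 * h1
  rw [rpow_two_mul_add hs, neg_div_four_pow]
  simp only [sinCoeff, List.map_cons, List.map_nil, List.prod_cons, List.prod_nil, mul_one]
  rw [← ascPochhammer_eval_three_halves, div_mul_eq_div_div_swap (Polynomial.eval (1 + a / 2) _), h6]
  field_simp

lemma cosSeries_eq_pFq {a s : ℝ} (ha : -1 < a) (hs : 0 < s) :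
    evenSeries (cosCoeff a) (a + 1) s =
      s ^ (a + 1) * pFq [(a + 1) / 2] [1 / 2, (a + 3) / 2] (-(s ^ 2) / 4) / (a + 1) := by
  unfold evenSeries pFq
  rw [mul_div_assoc, ← tsum_div_const, ← tsum_mul_left]
  refine tsum_congr fun n => ?_
  have hn : (0 : ℝ) ≤ n := n.cast_nonneg
  have h1 := ascPochhammer_eval_mul_add ((a + 1) / 2) n
  rw [show (a + 1) / 2 + 1 = (a + 3) / 2 by ring] at h1
  have h2 : (ascPochhammer ℝ n).eval ((a + 3) / 2) ≠ 0 := (ascPochhammer_pos n _ (by linarith)).ne'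
  have h3 : (ascPochhammer ℝ n).eval (1 / 2 : ℝ) ≠ 0 := (ascPochhammer_pos n _ (by norm_num)).ne'
  have h4 : 2 * (n : ℝ) + (a + 1) ≠ 0 := by intro h; linarith
  have h5 : a + 1 ≠ 0 := by intro h; linarith
  have h6 : (ascPochhammer ℝ n).eval ((a + 1) / 2) / (ascPochhammer ℝ n).eval ((a + 3) / 2) =
      (a + 1) / (2 * (n : ℝ) + (a + 1)) := by
    rw [div_eq_div_iff h2 h4]
    linear_combination 2 * h1
  rw [rpow_two_mul_add hs, neg_div_four_pow]
  simp only [cosCoeff, List.map_cons, List.map_nil, List.prod_cons, List.prod_nil, mul_one]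
  rw [← ascPochhammer_eval_half, div_mul_eq_div_div_swap (Polynomial.eval ((a + 1) / 2) _), h6]
  field_simp

lemma tailSeries_eq_pFq {a s : ℝ} (ha : ∀ n : ℤ, a ≠ n) (hs : 0 < s) :
    evenSeries (fun n => tailCoeff a n / ((n : ℝ) + 1)) 2 s =
      Real.Gamma (a - 1) * (s ^ 2 * pFq [1, 1] [2, 1 - a / 2, (3 - a) / 2] (-(s ^ 2) / 4)) := by
  unfold evenSeries pFq
  rw [← tsum_mul_left, ← tsum_mul_left]
  refine tsum_congr fun n => ?_
  have h1 : (ascPochhammer ℝ n).eval (1 - a / 2) ≠ 0 :=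
    ascPochhammer_eval_ne_zero (fun k h => ha (2 + 2 * k) (by push_cast; linarith)) n
  have h2 : (ascPochhammer ℝ n).eval ((3 - a) / 2) ≠ 0 :=
    ascPochhammer_eval_ne_zero (fun k h => ha (3 + 2 * k) (by push_cast; linarith)) n
  have h3 : (n : ℝ) + 1 ≠ 0 := by positivity
  rw [rpow_two_mul_add hs, neg_div_four_pow, Real.rpow_two, ← ascPochhammer_mul_Gamma ha n]
  simp only [tailCoeff, List.map_cons, List.map_nil, List.prod_cons, List.prod_nil, mul_one,
    ascPochhammer_eval_one, ascPochhammer_eval_two, Nat.factorial_succ]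
  push_cast
  generalize Polynomial.eval (1 - a / 2) (ascPochhammer ℝ n) = x at h1 ⊢
  field_simp

lemma rpow_inv_sqrt {κ : ℝ} (hκ : 0 < κ) (p : ℝ) : (√κ)⁻¹ ^ p = (κ ^ (p / 2))⁻¹ := by
  rw [Real.inv_rpow (Real.sqrt_nonneg κ), Real.sqrt_eq_rpow, ← Real.rpow_mul hκ.le,
    one_div_mul_eq_div]

/-- The integral behind both closed forms: `logMoment` at `s = κ^(-1/2)`, where `κ = b² c ρ`. -/
theorem integral_log_one_add_eq {a b c ρ : ℝ} (ha : -1 < a) (hn : ∀ n : ℤ, a ≠ n)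
    (hκ : 0 < b ^ 2 * c * ρ) :
    ∫ t in Ioi (0 : ℝ), t ^ a * Real.exp (-t) * Real.log (1 + b ^ 2 * c * ρ * t ^ 2) =
      Real.pi * (1 / Real.sin (a * Real.pi / 2)) * hypCsc a b c ρ /
          ((a + 2) * (b ^ 2 * c * ρ) ^ ((a + 2) / 2)) +
        Real.pi * (1 / Real.cos (a * Real.pi / 2)) * hypSec a b c ρ /
          ((a + 1) * (b ^ 2 * c * ρ) ^ ((a + 1) / 2)) +
        2 * deriv Real.Gamma (a + 1) + Real.Gamma (a + 1) * Real.log (b ^ 2 * c * ρ) +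
        Real.Gamma (a - 1) * (hypTail a b c ρ / (b ^ 2 * c * ρ)) := by
  have hz : hypArg b c ρ = -((b ^ 2 * c * ρ)⁻¹) / 4 := by
    unfold hypArg
    rw [show 4 * b ^ 2 * c * ρ = 4 * (b ^ 2 * c * ρ) by ring]
    field_simp
  unfold hypCsc hypSec hypTail
  rw [hz]
  set κ := b ^ 2 * c * ρ
  have hs : 0 < (√κ)⁻¹ := by positivity
  have hs2 : (√κ)⁻¹ ^ 2 = κ⁻¹ := by rw [inv_pow, Real.sq_sqrt hκ.le]
  have h := integral_log_one_add ha hs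
  rw [logMoment_eq ha hn hs, sinSeries_eq_pFq ha hs, cosSeries_eq_pFq ha hs,
    tailSeries_eq_pFq hn hs, hs2, inv_inv, Real.log_inv, Real.log_sqrt hκ.le,
    rpow_inv_sqrt hκ, rpow_inv_sqrt hκ] at h
  rw [h]
  have h1 : a + 1 ≠ 0 := by intro h; linarith
  have h2 : a + 2 ≠ 0 := by intro h; linarith
  simp only [div_eq_mul_inv, mul_inv]
  ring

/-! ### Laws with a density on the positive half-line -/

lemma integrable_withDensity_Ioi {w : ℝ → ℝ} (hw : Measurable w) (h0 : ∀ x, 0 < x → 0 ≤ w x)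
    (φ : ℝ → ℝ) :
    Integrable φ (volume.withDensity fun x => ENNReal.ofReal (if 0 < x then w x else 0)) ↔
      IntegrableOn (fun x => w x * φ x) (Ioi 0) := by
  rw [integrable_withDensity_iff_integrable_smul'
    (hw.ite measurableSet_Ioi measurable_const).ennreal_ofReal
    (by simp)]
  rw [← integrable_indicator_iff measurableSet_Ioi]
  refine integrable_congr (Eventually.of_forall fun x => ?_)
  by_cases hx : 0 < x
  · simp [hx, h0 x hx]
  · simp [hx]

lemma integral_withDensity_Ioi {w : ℝ → ℝ} (hw : Measurable w) (h0 : ∀ x, 0 < x → 0 ≤ w x)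
    (φ : ℝ → ℝ) :
    ∫ x, φ x ∂(volume.withDensity fun x => ENNReal.ofReal (if 0 < x then w x else 0)) =
      ∫ x in Ioi (0 : ℝ), w x * φ x := by
  rw [integral_withDensity_eq_integral_toReal_smul
    (hw.ite measurableSet_Ioi measurable_const).ennreal_ofReal
    (by simp)]
  rw [← integral_indicator measurableSet_Ioi]
  refine integral_congr_ae (Eventually.of_forall fun x => ?_)
  by_cases hx : 0 < x
  · simp [hx, h0 x hx]
  · simp [hx]

/-- The density of `gainLaw` on the positive half-line. -/
noncomputable def gainWeight (a b y : ℝ) : ℝ :=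
  √y ^ (a - 1) / (2 * b ^ (a + 1) * Real.Gamma (a + 1)) * Real.exp (-√y / b)

lemma measurable_gainWeight (a b : ℝ) : Measurable (gainWeight a b) := by
  unfold gainWeight; fun_prop

lemma gainWeight_nonneg {a b : ℝ} (ha : -1 < a) (hb : 0 < b) (y : ℝ) : 0 ≤ gainWeight a b y := by
  have : 0 < Real.Gamma (a + 1) := Real.Gamma_pos_of_pos (by linarith)
  unfold gainWeight; positivity

lemma gainWeight_substitution {a b t : ℝ} (ha : -1 < a) (hb : 0 < b) (ht : 0 < t) (φ : ℝ → ℝ) :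
    (2 * (b * t) ^ ((2 : ℝ) - 1)) • (gainWeight a b ((b * t) ^ (2 : ℝ)) * φ ((b * t) ^ (2 : ℝ))) =
      b⁻¹ * (t ^ a * Real.exp (-t) / Real.Gamma (a + 1) * φ (b ^ 2 * t ^ 2)) := by
  have hbt : 0 < b * t := by positivity
  have hG : Real.Gamma (a + 1) ≠ 0 := (Real.Gamma_pos_of_pos (by linarith)).ne'
  have h1 : (b * t) ^ (a - 1) = b ^ (a + 1) / b ^ 2 * (t ^ a / t) := by
    rw [Real.mul_rpow hb.le ht.le, show a - 1 = a + 1 - (2 : ℕ) by push_cast; ring,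
      Real.rpow_sub_natCast hb.ne', show a + 1 - (2 : ℕ) = a - 1 by push_cast; ring,
      Real.rpow_sub_one ht.ne']
  have h2 : b ^ (a + 1) ≠ 0 := (Real.rpow_pos_of_pos hb _).ne'
  unfold gainWeight
  rw [show (2 : ℝ) - 1 = 1 by norm_num, Real.rpow_one, Real.rpow_two, Real.sqrt_sq hbt.le, h1,
    smul_eq_mul, show -(b * t) / b = -t by field_simp, mul_pow]
  field_simp

/-- Under `gainLaw a b` the gain is `b² t²` with `t` Gamma distributed of shape `a + 1`. -/
lemma integral_gainLaw {a b : ℝ} (ha : -1 < a) (hb : 0 < b) (φ : ℝ → ℝ) :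
    ∫ y, φ y ∂(gainLaw a b) =
      ∫ t in Ioi (0 : ℝ), t ^ a * Real.exp (-t) / Real.Gamma (a + 1) * φ (b ^ 2 * t ^ 2) := by
  have h := integral_withDensity_Ioi (measurable_gainWeight a b)
    (fun y _ => gainWeight_nonneg ha hb y) φ
  change ∫ y, φ y ∂(gainLaw a b) = _ at h
  rw [h, ← integral_comp_rpow_Ioi_of_pos two_pos]
  have h2 := integral_comp_mul_left_Ioi (fun x : ℝ => (2 * x ^ ((2 : ℝ) - 1)) •
    (gainWeight a b (x ^ (2 : ℝ)) * φ (x ^ (2 : ℝ)))) 0 hb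
  rw [mul_zero, smul_eq_mul, eq_comm, inv_mul_eq_iff_eq_mul₀ hb.ne', ← integral_const_mul] at h2
  rw [h2]
  refine setIntegral_congr_fun measurableSet_Ioi fun t ht => ?_
  have := gainWeight_substitution ha hb ht φ
  simp only [this]
  field_simp

lemma integrable_gainLaw {a b : ℝ} (ha : -1 < a) (hb : 0 < b) (φ : ℝ → ℝ) :
    Integrable φ (gainLaw a b) ↔ IntegrableOn
      (fun t => t ^ a * Real.exp (-t) / Real.Gamma (a + 1) * φ (b ^ 2 * t ^ 2)) (Ioi 0) := by
  have h := integrable_withDensity_Ioi (measurable_gainWeight a b)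
    (fun y _ => gainWeight_nonneg ha hb y) φ
  change Integrable φ (gainLaw a b) ↔ _ at h
  rw [h, ← integrableOn_Ioi_comp_rpow_iff _ two_ne_zero, abs_two]
  have h2 := integrableOn_Ioi_comp_mul_left_iff (fun x : ℝ => (2 * x ^ ((2 : ℝ) - 1)) •
    (gainWeight a b (x ^ (2 : ℝ)) * φ (x ^ (2 : ℝ)))) 0 hb
  rw [mul_zero] at h2
  rw [← h2, integrableOn_congr_fun (fun t (ht : t ∈ Ioi (0 : ℝ)) => gainWeight_substitution ha hb ht φ)
    measurableSet_Ioi]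
  exact integrable_const_mul_iff (IsUnit.mk0 _ (inv_ne_zero hb.ne')) _

lemma moment_gainLaw {a b k : ℝ} (ha : -1 < a) (hb : 0 < b) (hk : 0 ≤ k) {φ : ℝ → ℝ}
    (hφ : ∀ t, 0 < t → φ (b ^ 2 * t ^ 2) = (b * t) ^ k) :
    Integrable φ (gainLaw a b) ∧
      ∫ y, φ y ∂(gainLaw a b) = b ^ k * Real.Gamma (a + k + 1) / Real.Gamma (a + 1) := by
  have key : ∀ t ∈ Ioi (0 : ℝ), t ^ a * Real.exp (-t) / Real.Gamma (a + 1) * φ (b ^ 2 * t ^ 2) =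
      b ^ k / Real.Gamma (a + 1) * (t ^ (a + k) * Real.exp (-t)) := by
    intro t ht
    have ht0 : (0 : ℝ) < t := ht
    rw [hφ t ht0, Real.mul_rpow hb.le ht0.le, Real.rpow_add ht0]
    ring
  constructor
  · rw [integrable_gainLaw ha hb, integrableOn_congr_fun key measurableSet_Ioi]
    exact (integrableOn_rpow_mul_exp_neg (by linarith)).const_mul _
  · rw [integral_gainLaw ha hb, setIntegral_congr_fun measurableSet_Ioi key,
      integral_const_mul, integral_rpow_mul_exp_neg (by linarith)]
    ring

lemma isProbabilityMeasure_gainLaw {a b : ℝ} (ha : -1 < a) (hb : 0 < b) :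
    IsProbabilityMeasure (gainLaw a b) := by
  obtain ⟨h1, h2⟩ := moment_gainLaw (φ := fun _ => 1) ha hb le_rfl (fun t _ => by simp)
  have hG : Real.Gamma (a + 1) ≠ 0 := (Real.Gamma_pos_of_pos (by linarith)).ne'
  rw [add_zero, Real.rpow_zero, one_mul, div_self hG, integral_const, smul_eq_mul, mul_one] at h2
  have : IsFiniteMeasure (gainLaw a b) := (integrable_const_iff_isFiniteMeasure one_ne_zero).1 h1
  exact ⟨by rw [← ofReal_measureReal, h2, ENNReal.ofReal_one]⟩

lemma mean_gainLaw {a b : ℝ} (ha : -1 < a) (hb : 0 < b) :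
    Integrable (fun y => y) (gainLaw a b) ∧
      ∫ y, y ∂(gainLaw a b) = b ^ 2 * ((a + 2) * (a + 1)) := by
  obtain ⟨h1, h2⟩ := moment_gainLaw (k := 2) (φ := fun y => y) ha hb two_pos.le
    (fun t _ => by rw [Real.rpow_two, mul_pow])
  refine ⟨h1, ?_⟩
  have hG : Real.Gamma (a + 1) ≠ 0 := (Real.Gamma_pos_of_pos (by linarith)).ne'
  rw [h2, Real.rpow_two, show a + 2 + 1 = a + 1 + 1 + 1 by ring, Real.Gamma_add_one (by linarith),
    Real.Gamma_add_one (by linarith)]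
  field_simp
  ring

lemma mean_sqrt_gainLaw {a b : ℝ} (ha : -1 < a) (hb : 0 < b) :
    ∫ y, √y ∂(gainLaw a b) = b * (a + 1) := by
  obtain ⟨h1, h2⟩ := moment_gainLaw (k := 1) (φ := fun y => √y) ha hb one_pos.le
    (fun t ht => by rw [Real.rpow_one, ← mul_pow, Real.sqrt_sq (by positivity)])
  have hG : Real.Gamma (a + 1) ≠ 0 := (Real.Gamma_pos_of_pos (by linarith)).ne'
  rw [h2, Real.rpow_one, Real.Gamma_add_one (by linarith)]
  field_simp

/-! ### Ergodic rates under the approximate law -/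

lemma rate_sinrDR1 (β₁ ρ y : ℝ) :
    rate (sinrDR1 β₁ ρ) y = (Real.log 2)⁻¹ * Real.log (1 + β₁ ^ 2 * ρ * y) := by
  unfold rate sinrDR1 Real.logb
  rw [show 1 + β₁ ^ 2 * y * ρ = 1 + β₁ ^ 2 * ρ * y by ring]
  ring

lemma rate_sinrDR2 {β₁ β₂ ρ y : ℝ} (hρ : 0 < ρ) (hy : 0 ≤ y) :
    rate (sinrDR2 β₁ β₂ ρ) y = (Real.log 2)⁻¹ *
      (Real.log (1 + (β₁ ^ 2 + β₂ ^ 2) * ρ * y) - Real.log (1 + β₁ ^ 2 * ρ * y)) := by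
  have h1 : 0 < 1 + β₁ ^ 2 * ρ * y := by positivity
  have h2 : 0 < 1 + (β₁ ^ 2 + β₂ ^ 2) * ρ * y := by positivity
  have h3 : y * β₁ ^ 2 * ρ + 1 ≠ 0 := by positivity
  unfold rate sinrDR2 Real.logb
  rw [← Real.log_div h2.ne' h1.ne', show 1 + y * β₂ ^ 2 * ρ / (y * β₁ ^ 2 * ρ + 1) =
    (1 + (β₁ ^ 2 + β₂ ^ 2) * ρ * y) / (1 + β₁ ^ 2 * ρ * y) by field_simp; ring]
  ring

/-- The integral of `tᵃ e⁻ᵗ log (1 + κ t²)`. -/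
noncomputable def gammaLogInt (a κ : ℝ) : ℝ :=
  ∫ t in Ioi (0 : ℝ), t ^ a * Real.exp (-t) * Real.log (1 + κ * t ^ 2)

lemma integrable_log_gainLaw {a b c ρ : ℝ} (ha : -1 < a) (hb : 0 < b) (hc : 0 < c) (hρ : 0 < ρ) :
    Integrable (fun y => Real.log (1 + c * ρ * y)) (gainLaw a b) ∧
      ∫ y, Real.log (1 + c * ρ * y) ∂(gainLaw a b) =
        (Real.Gamma (a + 1))⁻¹ * gammaLogInt a (b ^ 2 * c * ρ) := by
  have key : ∀ t : ℝ, t ^ a * Real.exp (-t) / Real.Gamma (a + 1) *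
      Real.log (1 + c * ρ * (b ^ 2 * t ^ 2)) = (Real.Gamma (a + 1))⁻¹ *
        (t ^ a * Real.exp (-t) * Real.log (1 + b ^ 2 * c * ρ * t ^ 2)) := by
    intro t
    rw [show c * ρ * (b ^ 2 * t ^ 2) = b ^ 2 * c * ρ * t ^ 2 by ring]
    ring
  rw [integrable_gainLaw ha hb, integral_gainLaw ha hb]
  simp_rw [key]
  rw [integral_const_mul]
  exact ⟨(integrableOn_log_one_add ha (by positivity)).const_mul _, rfl⟩

lemma ae_gainLaw_nonneg (a b : ℝ) : ∀ᵐ y ∂(gainLaw a b), 0 ≤ y := by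
  have hm : Measurable fun y => ENNReal.ofReal (gainPDF a b y) :=
    ((measurable_gainWeight a b).ite measurableSet_Ioi measurable_const).ennreal_ofReal
  rw [gainLaw, ae_withDensity_iff hm]
  refine Eventually.of_forall fun y hy => ?_
  by_contra h
  have h' : ¬ 0 < y := fun h0 => h h0.le
  simp [gainPDF, h'] at hy

lemma ergodicRate_gainLaw_DR1 {a b β₁ ρ : ℝ} (ha : -1 < a) (hb : 0 < b) (hβ : 0 < β₁)
    (hρ : 0 < ρ) : Integrable (rate (sinrDR1 β₁ ρ)) (gainLaw a b) ∧
      ergodicRate (gainLaw a b) (sinrDR1 β₁ ρ) =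
        1 / (Real.log 2 * Real.Gamma (a + 1)) * gammaLogInt a (b ^ 2 * β₁ ^ 2 * ρ) := by
  obtain ⟨h1, h2⟩ := integrable_log_gainLaw (c := β₁ ^ 2) ha hb (by positivity) hρ
  have h : rate (sinrDR1 β₁ ρ) = fun y => (Real.log 2)⁻¹ * Real.log (1 + β₁ ^ 2 * ρ * y) :=
    funext fun y => rate_sinrDR1 β₁ ρ y
  unfold ergodicRate
  rw [h]
  refine ⟨h1.const_mul _, ?_⟩
  rw [integral_const_mul, h2]
  ring

lemma ergodicRate_gainLaw_DR2 {a b β₁ β₂ ρ : ℝ} (ha : -1 < a) (hb : 0 < b) (hβ : 0 < β₁)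
    (hρ : 0 < ρ) : Integrable (rate (sinrDR2 β₁ β₂ ρ)) (gainLaw a b) ∧
      ergodicRate (gainLaw a b) (sinrDR2 β₁ β₂ ρ) =
        1 / (Real.log 2 * Real.Gamma (a + 1)) *
          (gammaLogInt a (b ^ 2 * (β₁ ^ 2 + β₂ ^ 2) * ρ) -
            gammaLogInt a (b ^ 2 * β₁ ^ 2 * ρ)) := by
  obtain ⟨h1, h2⟩ := integrable_log_gainLaw (c := β₁ ^ 2) ha hb (by positivity) hρ
  obtain ⟨h3, h4⟩ := integrable_log_gainLaw (c := β₁ ^ 2 + β₂ ^ 2) ha hb (by positivity) hρ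
  have h : rate (sinrDR2 β₁ β₂ ρ) =ᵐ[gainLaw a b] fun y => (Real.log 2)⁻¹ *
      (Real.log (1 + (β₁ ^ 2 + β₂ ^ 2) * ρ * y) - Real.log (1 + β₁ ^ 2 * ρ * y)) := by
    filter_upwards [ae_gainLaw_nonneg a b] with y hy using rate_sinrDR2 hρ hy
  unfold ergodicRate
  rw [integrable_congr h, integral_congr_ae h]
  refine ⟨(h3.sub h1).const_mul _, ?_⟩
  rw [integral_const_mul, integral_sub h3 h1, h2, h4]
  ring

lemma Gamma_add_one_eq {a : ℝ} (hn : ∀ n : ℤ, a ≠ n) :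
    Real.Gamma (a + 1) = a * (a - 1) * Real.Gamma (a - 1) := by
  have h0 : a ≠ 0 := by simpa using hn 0
  have h1 : a - 1 ≠ 0 := sub_ne_zero.2 (by simpa using hn 1)
  have h2 := Real.Gamma_add_one h1
  rw [sub_add_cancel] at h2
  rw [Real.Gamma_add_one h0, h2, mul_assoc]

/-- Splits powers of `κ = b² c ρ` into the powers that the closed forms write. -/
lemma sq_mul_rpow_half {b x : ℝ} (hb : 0 < b) (hx : 0 ≤ x) (p : ℝ) :
    (b ^ 2 * x) ^ (p / 2) = b ^ p * x ^ (p / 2) := by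
  rw [Real.mul_rpow (by positivity) hx, ← Real.rpow_two, ← Real.rpow_mul hb.le]
  congr 2
  ring

lemma closedFormDR1_eq {a b β₁ ρ : ℝ} (ha : -1 < a) (hb : 0 < b) (hβ : 0 < β₁) (hρ : 0 < ρ)
    (hn : ∀ n : ℤ, a ≠ n) :
    closedFormDR1 a b β₁ ρ =
      1 / (Real.log 2 * Real.Gamma (a + 1)) * gammaLogInt a (b ^ 2 * β₁ ^ 2 * ρ) := by
  have hG : Real.Gamma (a + 1) ≠ 0 := (Real.Gamma_pos_of_pos (by linarith)).ne'
  have hψ : 2 * a * (a - 1) * Real.Gamma (a - 1) * realDigamma (a + 1) =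
      2 * deriv Real.Gamma (a + 1) := by
    rw [realDigamma, logDeriv_apply, show 2 * a * (a - 1) * Real.Gamma (a - 1) =
      2 * (a * (a - 1) * Real.Gamma (a - 1)) by ring, ← Gamma_add_one_eq hn]
    field_simp
  have hpow : ∀ p : ℝ, (b ^ 2 * β₁ ^ 2 * ρ) ^ (p / 2) = (β₁ * b) ^ p * ρ ^ (p / 2) := by
    intro p
    rw [← sq_mul_rpow_half (by positivity) hρ.le, mul_pow, mul_comm (b ^ 2)]
  unfold closedFormDR1 gammaLogInt
  rw [integral_log_one_add_eq ha hn (by positivity), hψ, hpow, hpow, Gamma_add_one_eq hn,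
    show a / 2 + 1 = (a + 2) / 2 by ring]
  ring

lemma closedFormDR2_eq {a b c₁ c₂ ρ : ℝ} (ha : -1 < a) (hb : 0 < b) (hc₁ : 0 < c₁) (hc₂ : 0 < c₂)
    (hρ : 0 < ρ) (hn : ∀ n : ℤ, a ≠ n) :
    closedFormDR2 a b c₁ c₂ ρ = 1 / (Real.log 2 * Real.Gamma (a + 1)) *
      (gammaLogInt a (b ^ 2 * c₁ * ρ) - gammaLogInt a (b ^ 2 * c₂ * ρ)) := by
  have hpow : ∀ c : ℝ, 0 < c → ∀ p : ℝ,
      (b ^ 2 * c * ρ) ^ (p / 2) = b ^ p * (c * ρ) ^ (p / 2) := by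
    intro c hc p
    rw [mul_assoc, sq_mul_rpow_half hb (by positivity)]
  have hlog : Real.log (b ^ 2 * c₁ * ρ) - Real.log (b ^ 2 * c₂ * ρ) = Real.log (c₁ / c₂) := by
    rw [← Real.log_div (by positivity) (by positivity)]
    congr 1
    field_simp
  unfold closedFormDR2 gammaLogInt
  rw [integral_log_one_add_eq ha hn (by positivity), integral_log_one_add_eq ha hn (by positivity),
    hpow c₁ hc₁, hpow c₁ hc₁, hpow c₂ hc₂, hpow c₂ hc₂, Gamma_add_one_eq hn, ← hlog,
    show a / 2 + 1 = (a + 2) / 2 by ring]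
  simp only [div_eq_mul_inv, mul_inv]
  ring

/-! ### Moments of the Nakagami law and of the reflected amplitude -/

/-- The density of `nakagamiLaw` on the positive half-line. -/
noncomputable def nakagamiWeight (m Ω x : ℝ) : ℝ :=
  2 * m ^ m / (Real.Gamma m * Ω ^ m) * x ^ (2 * m - 1) * Real.exp (-(m / Ω) * x ^ 2)

lemma moment_nakagami {m Ω k : ℝ} (hm : 0 < m) (hΩ : 0 < Ω) (hk : 0 ≤ k) {φ : ℝ → ℝ}
    (hφ : ∀ x, 0 < x → φ x = x ^ k) :
    Integrable φ (nakagamiLaw m Ω) ∧ ∫ x, φ x ∂(nakagamiLaw m Ω) =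
      (m / Ω) ^ (-(k / 2)) * Real.Gamma (m + k / 2) / Real.Gamma m := by
  have hG := Real.Gamma_pos_of_pos hm
  have hmeas : Measurable (nakagamiWeight m Ω) := by unfold nakagamiWeight; fun_prop
  have hnn : ∀ x, 0 < x → 0 ≤ nakagamiWeight m Ω x := fun x hx => by
    unfold nakagamiWeight; positivity
  have h1 := integrable_withDensity_Ioi hmeas hnn φ
  change Integrable φ (nakagamiLaw m Ω) ↔ _ at h1
  have h2 := integral_withDensity_Ioi hmeas hnn φ
  change ∫ x, φ x ∂(nakagamiLaw m Ω) = _ at h2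
  have key : ∀ x ∈ Ioi (0 : ℝ), nakagamiWeight m Ω x * φ x =
      2 * m ^ m / (Real.Gamma m * Ω ^ m) *
        (x ^ (2 * m - 1 + k) * Real.exp (-(m / Ω) * x ^ (2 : ℝ))) := by
    intro x hx
    rw [hφ x hx, Real.rpow_add hx, Real.rpow_two, nakagamiWeight]
    ring
  have hmΩ : 0 < m / Ω := by positivity
  rw [h1, h2, integrableOn_congr_fun key measurableSet_Ioi,
    setIntegral_congr_fun measurableSet_Ioi key, integral_const_mul,
    integral_rpow_mul_exp_neg_mul_rpow two_pos (by linarith) hmΩ]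
  refine ⟨(integrableOn_rpow_mul_exp_neg_mul_rpow (by linarith) two_pos hmΩ).const_mul _, ?_⟩
  -- The factor `mᵐ / Ωᵐ` cancels the normalization of the density.
  have hexp : (m / Ω) ^ (-(2 * m - 1 + k + 1) / 2) = (m / Ω) ^ (-(k / 2)) * (m ^ m / Ω ^ m)⁻¹ := by
    rw [← Real.div_rpow hm.le hΩ.le, ← Real.rpow_neg hmΩ.le, ← Real.rpow_add hmΩ]
    congr 1
    ring
  rw [hexp, show (2 * m - 1 + k + 1) / 2 = m + k / 2 by ring]
  have : m ^ m ≠ 0 := (Real.rpow_pos_of_pos hm _).ne'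
  have : Ω ^ m ≠ 0 := (Real.rpow_pos_of_pos hΩ _).ne'
  field_simp

/-- The mean of the Nakagami law. -/
noncomputable def nakagamiMean (m Ω : ℝ) : ℝ :=
  Real.Gamma (m + 1 / 2) / (√(m / Ω) * Real.Gamma m)

variable {S : Type*}

/-- The sum of the reflected amplitudes. -/
noncomputable def reflectedAmplitude {N : ℕ} (gbar g : Fin N → S → ℂ) (s : S) : ℝ :=
  ∑ i, ‖gbar i s‖ * ‖g i s‖

lemma reflectedAmplitude_nonneg {N : ℕ} (gbar g : Fin N → S → ℂ) (s : S) :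
    0 ≤ reflectedAmplitude gbar g s :=
  Finset.sum_nonneg fun _ _ => by positivity

lemma reflectedGain_eq {N : ℕ} (gbar g : Fin N → S → ℂ) :
    reflectedGain gbar g = fun s => reflectedAmplitude gbar g s ^ 2 := rfl

lemma reflectedGain_le_gain {N : ℕ} (h : S → ℂ) (gbar g : Fin N → S → ℂ) (s : S) :
    reflectedGain gbar g s ≤ gain h gbar g s :=
  pow_le_pow_left₀ (reflectedAmplitude_nonneg gbar g s)
    (le_add_of_nonneg_left (norm_nonneg _)) 2

variable [MeasurableSpace S] {P : Measure S}

lemma nakagami_moments {m Ω : ℝ} (hm : 0 < m) (hΩ : 0 < Ω) {X : S → ℝ}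
    (hX : HasLaw X (nakagamiLaw m Ω) P) :
    Integrable X P ∧ Integrable (fun s => X s ^ 2) P ∧
      ∫ s, X s ∂P = nakagamiMean m Ω ∧ ∫ s, X s ^ 2 ∂P = Ω := by
  obtain ⟨h1, h2⟩ := moment_nakagami (k := 1) (φ := fun x => x) hm hΩ one_pos.le (by simp)
  obtain ⟨h3, h4⟩ := moment_nakagami (k := 2) (φ := fun x => x ^ 2) hm hΩ two_pos.le (by simp)
  have hG : Real.Gamma m ≠ 0 := (Real.Gamma_pos_of_pos hm).ne'
  rw [← hX.map_eq] at h1 h3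
  refine ⟨h1.comp_aemeasurable hX.aemeasurable, h3.comp_aemeasurable hX.aemeasurable, ?_, ?_⟩
  · have := hX.integral_comp (f := fun x => x) (by fun_prop)
    rw [h2] at this
    refine Eq.trans this ?_
    rw [Real.rpow_neg (by positivity), ← Real.sqrt_eq_rpow, nakagamiMean]
    field_simp
  · have := hX.integral_comp (f := fun x => x ^ 2) (by fun_prop)
    rw [h4] at this
    refine Eq.trans this ?_
    rw [div_self two_ne_zero, Real.rpow_neg (by positivity), Real.rpow_one,
      Real.Gamma_add_one hm.ne']
    field_simp

/-- Distinct products `|ḡᵢ| |gᵢ|` are independent, so their variances add up. -/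
lemma reflectedAmplitude_moments [IsProbabilityMeasure P] {N : ℕ} {h : S → ℂ}
    {gbar g : Fin N → S → ℂ} {mh Ωh m₀ Ω₀ m Ω : ℝ}
    (link : IsNakagamiLink P h gbar g mh Ωh m₀ Ω₀ m Ω)
    (hm₀ : 0 < m₀) (hΩ₀ : 0 < Ω₀) (hm : 0 < m) (hΩ : 0 < Ω) :
    MemLp (reflectedAmplitude gbar g) 2 P ∧
      ∫ s, reflectedAmplitude gbar g s ∂P = N * (nakagamiMean m₀ Ω₀ * nakagamiMean m Ω) ∧
      ∫ s, reflectedAmplitude gbar g s ^ 2 ∂P =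
        (N * (nakagamiMean m₀ Ω₀ * nakagamiMean m Ω)) ^ 2 +
          N * (Ω₀ * Ω - (nakagamiMean m₀ Ω₀ * nakagamiMean m Ω) ^ 2) := by
  set F : Fin N ⊕ Fin N → S → ℝ := Sum.elim (fun i s => ‖gbar i s‖) (fun i s => ‖g i s‖) with hF
  set X : Fin N → S → ℝ := fun i => F (Sum.inl i) * F (Sum.inr i) with hX
  have hFm : ∀ k, AEMeasurable (F k) P := by
    rintro (i | i)
    · exact (link.incident i).aemeasurable
    · exact (link.reflected i).aemeasurable
  have hind : ∀ i, IndepFun (F (Sum.inl i)) (F (Sum.inr i)) P := fun i =>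
    link.indep.indepFun (by simp)
  have hXm : ∀ i, AEMeasurable (X i) P := fun i => (hFm _).mul (hFm _)
  have hXmean : ∀ i, Integrable (X i) P ∧
      ∫ s, X i s ∂P = nakagamiMean m₀ Ω₀ * nakagamiMean m Ω := by
    intro i
    obtain ⟨h1, -, h2, -⟩ := nakagami_moments hm₀ hΩ₀ (link.incident i)
    obtain ⟨h3, -, h4, -⟩ := nakagami_moments hm hΩ (link.reflected i)
    refine ⟨(hind i).integrable_mul h1 h3, ?_⟩
    rw [← h2, ← h4]
    exact (hind i).integral_mul_eq_mul_integral (hFm _).aestronglyMeasurable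
      (hFm _).aestronglyMeasurable
  have hXsq : ∀ i, Integrable (fun s => X i s ^ 2) P ∧ ∫ s, X i s ^ 2 ∂P = Ω₀ * Ω := by
    intro i
    obtain ⟨-, h1, -, h2⟩ := nakagami_moments hm₀ hΩ₀ (link.incident i)
    obtain ⟨-, h3, -, h4⟩ := nakagami_moments hm hΩ (link.reflected i)
    have hind2 : IndepFun (fun s => F (Sum.inl i) s ^ 2) (fun s => F (Sum.inr i) s ^ 2) P :=
      (hind i).comp (φ := fun x : ℝ => x ^ 2) (ψ := fun x : ℝ => x ^ 2) (by fun_prop) (by fun_prop)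
    have he : (fun s => X i s ^ 2) =
        (fun s => F (Sum.inl i) s ^ 2) * (fun s => F (Sum.inr i) s ^ 2) := by
      funext s
      simp only [hX, Pi.mul_apply, mul_pow]
    rw [he]
    refine ⟨hind2.integrable_mul h1 h3, ?_⟩
    refine (hind2.integral_mul_eq_mul_integral ((hFm _).pow_const 2).aestronglyMeasurable
      ((hFm _).pow_const 2).aestronglyMeasurable).trans ?_
    rw [← h2, ← h4]
    rfl
  have hXL : ∀ i, MemLp (X i) 2 P := fun i =>
    (memLp_two_iff_integrable_sq (hXm i).aestronglyMeasurable).2 (hXsq i).1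
  have hsum : reflectedAmplitude gbar g = ∑ i, X i := by
    funext s
    rw [Finset.sum_apply]
    rfl
  have hL : MemLp (∑ i, X i) 2 P := memLp_finsetSum' _ fun i _ => hXL i
  have hmean : ∫ s, (∑ i, X i) s ∂P = N * (nakagamiMean m₀ Ω₀ * nakagamiMean m Ω) := by
    simp_rw [Finset.sum_apply]
    rw [integral_finsetSum _ fun i _ => (hXmean i).1]
    simp [(hXmean _).2]
  have hpair : ((Finset.univ : Finset (Fin N)) : Set (Fin N)).Pairwise
      fun i j => IndepFun (X i) (X j) P := fun i _ j _ hij =>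
    link.indep.indepFun_mul_mul₀ hFm _ _ _ _ (by simpa using hij) (by simp) (by simp)
      (by simpa using hij)
  have hvar := IndepFun.variance_sum (fun i _ => hXL i) hpair
  have hvi : ∀ i, variance (X i) P = Ω₀ * Ω - (nakagamiMean m₀ Ω₀ * nakagamiMean m Ω) ^ 2 := by
    intro i
    rw [variance_eq_sub (hXL i), (hXmean i).2, ← (hXsq i).2]
    rfl
  rw [variance_eq_sub hL, hmean] at hvar
  simp only [hvi, Finset.sum_const, Finset.card_univ, Fintype.card_fin, nsmul_eq_mul] at hvar
  rw [hsum]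
  refine ⟨hL, hmean, ?_⟩
  rw [← hvar]
  simp only [Pi.pow_apply]
  ring

/-! ### Dropping the direct link -/

/-- The ergodic rate is finite for gains with finite mean and increases with the gain. -/
lemma ergodicRate_mono {sinr : ℝ → ℝ} (hm : Measurable sinr) (h0 : ∀ y, 0 ≤ y → 0 ≤ sinr y)
    (hmono : ∀ x y, 0 ≤ x → x ≤ y → sinr x ≤ sinr y) {C : ℝ}
    (hC : ∀ y, 0 ≤ y → sinr y ≤ C * y) {G H : S → ℝ} (hG : AEMeasurable G P)
    (hH : AEMeasurable H P) (hG0 : ∀ s, 0 ≤ G s) (hGH : ∀ s, G s ≤ H s) (hHi : Integrable H P) :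
    Integrable (rate sinr) (P.map H) ∧ Integrable (rate sinr) (P.map G) ∧
      ergodicRate (P.map G) sinr ≤ ergodicRate (P.map H) sinr := by
  have hr : Measurable (rate sinr) := by
    unfold rate Real.logb; fun_prop
  have hlog2 : 0 < Real.log 2 := Real.log_pos one_lt_two
  have hr0 : ∀ y, 0 ≤ y → 0 ≤ rate sinr y := fun y hy =>
    Real.logb_nonneg one_lt_two (by linarith [h0 y hy])
  have hrmono : ∀ x y, 0 ≤ x → x ≤ y → rate sinr x ≤ rate sinr y := fun x y hx hxy =>
    Real.logb_le_logb_of_le one_lt_two (by linarith [h0 x hx]) (by linarith [hmono x y hx hxy])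
  have hrC : ∀ y, 0 ≤ y → rate sinr y ≤ C / Real.log 2 * y := by
    intro y hy
    have h1 := Real.log_le_sub_one_of_pos (by linarith [h0 y hy] : 0 < 1 + sinr y)
    have h2 := hC y hy
    rw [rate, Real.logb, div_mul_eq_mul_div]
    gcongr
    linarith
  have hH0 : ∀ s, 0 ≤ H s := fun s => (hG0 s).trans (hGH s)
  have hrH : Integrable (rate sinr ∘ H) P := by
    refine (hHi.const_mul (C / Real.log 2)).mono' (hr.comp_aemeasurable hH).aestronglyMeasurable
      (Eventually.of_forall fun s => ?_)
    rw [Function.comp, Real.norm_of_nonneg (hr0 _ (hH0 s))]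
    exact hrC _ (hH0 s)
  have hrG : Integrable (rate sinr ∘ G) P := by
    refine hrH.mono' (hr.comp_aemeasurable hG).aestronglyMeasurable
      (Eventually.of_forall fun s => ?_)
    rw [Function.comp, Real.norm_of_nonneg (hr0 _ (hG0 s))]
    exact hrmono _ _ (hG0 s) (hGH s)
  refine ⟨(integrable_map_measure hr.aestronglyMeasurable hH).2 hrH,
    (integrable_map_measure hr.aestronglyMeasurable hG).2 hrG, ?_⟩
  unfold ergodicRate
  rw [integral_map hH hr.aestronglyMeasurable, integral_map hG hr.aestronglyMeasurable]
  exact integral_mono hrG hrH fun s => hrmono _ _ (hG0 s) (hGH s)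

section Link
variable [IsProbabilityMeasure P] {N : ℕ} {h : S → ℂ} {gbar g : Fin N → S → ℂ}
  {mh Ωh m₀ Ω₀ m Ω : ℝ}

/-- The direct link needs no independence from the reflected channels: a sum of two square-integrable
amplitudes is square integrable. -/
lemma gain_regularity (link : IsNakagamiLink P h gbar g mh Ωh m₀ Ω₀ m Ω)
    (hmh : 0 < mh) (hΩh : 0 < Ωh)
    (hm₀ : 0 < m₀) (hΩ₀ : 0 < Ω₀) (hm : 0 < m) (hΩ : 0 < Ω) :
    AEMeasurable (reflectedGain gbar g) P ∧ AEMeasurable (gain h gbar g) P ∧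
      Integrable (gain h gbar g) P := by
  obtain ⟨hA, -, -⟩ := reflectedAmplitude_moments link hm₀ hΩ₀ hm hΩ
  have hd := link.direct.aemeasurable
  have hdL : MemLp (fun s => ‖h s‖) 2 P :=
    (memLp_two_iff_integrable_sq hd.aestronglyMeasurable).2
      (nakagami_moments hmh hΩh link.direct).2.1
  have hAm := hA.aestronglyMeasurable.aemeasurable
  exact ⟨hAm.pow_const 2, (hd.add hAm).pow_const 2, (hdL.add hA).integrable_sq⟩

lemma ergodicRate_DR1_mono (link : IsNakagamiLink P h gbar g mh Ωh m₀ Ω₀ m Ω)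
    (hmh : 0 < mh) (hΩh : 0 < Ωh)
    (hm₀ : 0 < m₀) (hΩ₀ : 0 < Ω₀) (hm : 0 < m) (hΩ : 0 < Ω) {β₁ ρ : ℝ} (hρ : 0 < ρ) :
    Integrable (rate (sinrDR1 β₁ ρ)) (P.map (gain h gbar g)) ∧
      Integrable (rate (sinrDR1 β₁ ρ)) (P.map (reflectedGain gbar g)) ∧
      ergodicRate (P.map (reflectedGain gbar g)) (sinrDR1 β₁ ρ) ≤
        ergodicRate (P.map (gain h gbar g)) (sinrDR1 β₁ ρ) := by
  obtain ⟨h1, h2, h3⟩ := gain_regularity link hmh hΩh hm₀ hΩ₀ hm hΩ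
  refine ergodicRate_mono (C := β₁ ^ 2 * ρ) (by unfold sinrDR1; fun_prop)
    (fun y hy => by unfold sinrDR1; positivity)
    (fun x y hx hxy => by unfold sinrDR1; gcongr)
    (fun y hy => by unfold sinrDR1; linarith) h1 h2 (fun s => sq_nonneg _)
    (reflectedGain_le_gain h gbar g) h3

lemma ergodicRate_DR2_mono (link : IsNakagamiLink P h gbar g mh Ωh m₀ Ω₀ m Ω)
    (hmh : 0 < mh) (hΩh : 0 < Ωh)
    (hm₀ : 0 < m₀) (hΩ₀ : 0 < Ω₀) (hm : 0 < m) (hΩ : 0 < Ω) {β₁ β₂ ρ : ℝ} (hρ : 0 < ρ) :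
    Integrable (rate (sinrDR2 β₁ β₂ ρ)) (P.map (gain h gbar g)) ∧
      Integrable (rate (sinrDR2 β₁ β₂ ρ)) (P.map (reflectedGain gbar g)) ∧
      ergodicRate (P.map (reflectedGain gbar g)) (sinrDR2 β₁ β₂ ρ) ≤
        ergodicRate (P.map (gain h gbar g)) (sinrDR2 β₁ β₂ ρ) := by
  obtain ⟨h1, h2, h3⟩ := gain_regularity link hmh hΩh hm₀ hΩ₀ hm hΩ
  refine ergodicRate_mono (C := β₂ ^ 2 * ρ) (by unfold sinrDR2; fun_prop)
    (fun y hy => by unfold sinrDR2; positivity) (fun x y hx hxy => ?_)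
    (fun y hy => ?_) h1 h2 (fun s => sq_nonneg _) (reflectedGain_le_gain h gbar g) h3
  · have hy : 0 ≤ y := hx.trans hxy
    unfold sinrDR2
    rw [div_le_div_iff₀ (by positivity) (by positivity)]
    have : x * β₂ ^ 2 * ρ ≤ y * β₂ ^ 2 * ρ := by gcongr
    linarith
  · unfold sinrDR2
    have h4 : 0 ≤ y * β₁ ^ 2 * ρ := by positivity
    refine (div_le_self (by positivity) (by linarith)).trans_eq (by ring)

/-! ### Matching the first two moments -/

/-- The strict inequality follows from log-convexity of `Γ` at `m + 1`, since the quotient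
`m Γ(m)² / Γ(m + 1/2)²` strictly decreases when `m` grows by one. -/
lemma Gamma_add_half_sq_lt {m : ℝ} (hm : 0 < m) :
    Real.Gamma (m + 1 / 2) ^ 2 < m * Real.Gamma m ^ 2 := by
  have h1 : Real.Gamma (m + 1 + 1 / 2) ^ 2 ≤ (m + 1) * Real.Gamma (m + 1) ^ 2 := by
    have h := Real.Gamma_mul_add_mul_le_rpow_Gamma_mul_rpow_Gamma (s := m + 1) (t := m + 1 + 1)
      (a := 1 / 2) (b := 1 / 2) (by linarith) (by linarith) (by norm_num) (by norm_num)
      (by norm_num)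
    rw [← Real.sqrt_eq_rpow, ← Real.sqrt_eq_rpow, show 1 / 2 * (m + 1) + 1 / 2 * (m + 1 + 1) =
      m + 1 + 1 / 2 by ring] at h
    have hp := Real.Gamma_pos_of_pos (by linarith : 0 < m + 1)
    have hp2 := Real.Gamma_pos_of_pos (by linarith : 0 < m + 1 + 1)
    have hp3 := Real.Gamma_pos_of_pos (by linarith : 0 < m + 1 + 1 / 2)
    calc _ ≤ (√(Real.Gamma (m + 1)) * √(Real.Gamma (m + 1 + 1))) ^ 2 := by gcongr
      _ = _ := by
        rw [mul_pow, Real.sq_sqrt hp.le, Real.sq_sqrt hp2.le,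
          Real.Gamma_add_one (by linarith : m + 1 ≠ 0)]
        ring
  have hp := Real.Gamma_pos_of_pos hm
  rw [Real.Gamma_add_one hm.ne', show m + 1 + 1 / 2 = m + 1 / 2 + 1 by ring,
    Real.Gamma_add_one (by linarith : m + 1 / 2 ≠ 0)] at h1
  have h2 : (m + 1 / 2) ^ 2 * Real.Gamma (m + 1 / 2) ^ 2 < (m + 1 / 2) ^ 2 * (m * Real.Gamma m ^ 2) := by
    have : 0 < m * Real.Gamma m ^ 2 := by positivity
    nlinarith
  exact lt_of_mul_lt_mul_left h2 (by positivity)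

/-- The parameters of the fit: `b (a + 1)` is the mean amplitude of the `N` reflected channels, and
`b` times the mean amplitude of one of them is its variance. -/
lemma fit_params {N : ℕ} (hN : 1 ≤ N) (hm₀ : 0 < m₀) (hΩ₀ : 0 < Ω₀) (hm : 0 < m) (hΩ : 0 < Ω) :
    0 < fitA N m₀ m + 1 ∧ 0 < fitB m₀ Ω₀ m Ω ∧
      fitB m₀ Ω₀ m Ω * (fitA N m₀ m + 1) = N * (nakagamiMean m₀ Ω₀ * nakagamiMean m Ω) ∧
      fitB m₀ Ω₀ m Ω * (nakagamiMean m₀ Ω₀ * nakagamiMean m Ω) =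
        Ω₀ * Ω - (nakagamiMean m₀ Ω₀ * nakagamiMean m Ω) ^ 2 := by
  have hN' : (0 : ℝ) < N := by exact_mod_cast hN
  have hG₀ := Real.Gamma_pos_of_pos hm₀
  have hG := Real.Gamma_pos_of_pos hm
  have hq₀ := Real.Gamma_pos_of_pos (by linarith : 0 < m₀ + 1 / 2)
  have hq := Real.Gamma_pos_of_pos (by linarith : 0 < m + 1 / 2)
  have hD : 0 < m₀ * Real.Gamma m₀ ^ 2 * (m * Real.Gamma m ^ 2) -
      Real.Gamma (m₀ + 1 / 2) ^ 2 * Real.Gamma (m + 1 / 2) ^ 2 :=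
    sub_pos.2 (mul_lt_mul'' (Gamma_add_half_sq_lt hm₀) (Gamma_add_half_sq_lt hm)
      (by positivity) (by positivity))
  have hr₀ : √(m₀ / Ω₀) ^ 2 = m₀ / Ω₀ := Real.sq_sqrt (by positivity)
  have hr : √(m / Ω) ^ 2 = m / Ω := Real.sq_sqrt (by positivity)
  have hr₀' : 0 < √(m₀ / Ω₀) := by positivity
  have hr' : 0 < √(m / Ω) := by positivity
  unfold fitA fitB nakagamiMean
  generalize Real.Gamma (m₀ + 1 / 2) = q₀ at *
  generalize Real.Gamma (m + 1 / 2) = q at *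
  generalize Real.Gamma m₀ = G₀ at *
  generalize Real.Gamma m = G at *
  generalize √(m₀ / Ω₀) = r₀ at *
  generalize √(m / Ω) = r at *
  have ha : m₀ * G₀ ^ 2 * N * (m * G ^ 2) / (m₀ * G₀ ^ 2 * (m * G ^ 2) - q₀ ^ 2 * q ^ 2) - N - 1 + 1 =
      N * (q₀ ^ 2 * q ^ 2) / (m₀ * G₀ ^ 2 * (m * G ^ 2) - q₀ ^ 2 * q ^ 2) := by
    have := hD.ne'
    rw [eq_div_iff this, sub_add_cancel, sub_mul, div_mul_cancel₀ _ this]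
    ring
  -- Eliminating the spreads makes the remaining identities rational in the roots `r₀` and `r`.
  have hΩ₀' : Ω₀ = m₀ / r₀ ^ 2 := by rw [hr₀]; field_simp
  have hΩ' : Ω = m / r ^ 2 := by rw [hr]; field_simp
  rw [ha]
  refine ⟨by positivity, by positivity, ?_, ?_⟩
  · have := hD.ne'
    generalize m₀ * G₀ ^ 2 * (m * G ^ 2) - q₀ ^ 2 * q ^ 2 = D at *
    field_simp
  · rw [hΩ₀', hΩ']
    field_simp

lemma matchesMeans_gainLaw (link : IsNakagamiLink P h gbar g mh Ωh m₀ Ω₀ m Ω)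
    (hN : 1 ≤ N) (hm₀ : 0 < m₀) (hΩ₀ : 0 < Ω₀) (hm : 0 < m) (hΩ : 0 < Ω) :
    MatchesMeans (gainLaw (fitA N m₀ m) (fitB m₀ Ω₀ m Ω)) (P.map (reflectedGain gbar g)) := by
  obtain ⟨h1, h2, h3, h4⟩ := fit_params (m₀ := m₀) (Ω₀ := Ω₀) (m := m) (Ω := Ω) hN hm₀ hΩ₀ hm hΩ
  obtain ⟨hL, hmean, hsq⟩ := reflectedAmplitude_moments link hm₀ hΩ₀ hm hΩ
  have ha : -1 < fitA N m₀ m := by linarith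
  have hAm : AEMeasurable (reflectedGain gbar g) P :=
    hL.aestronglyMeasurable.aemeasurable.pow_const 2
  refine ⟨isProbabilityMeasure_gainLaw ha h2, (mean_gainLaw ha h2).1, ?_, ?_, ?_⟩
  · exact (integrable_map_measure (by fun_prop) hAm).2 hL.integrable_sq
  · rw [(mean_gainLaw ha h2).2, integral_map hAm (by fun_prop)]
    simp only [reflectedGain_eq]
    rw [hsq, ← h4, ← h3]
    linear_combination fitB m₀ Ω₀ m Ω * h3
  · rw [mean_sqrt_gainLaw ha h2, integral_map hAm (by fun_prop), h3, ← hmean]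
    simp only [reflectedGain_eq, Real.sqrt_sq (reflectedAmplitude_nonneg gbar g _)]

end Link

end

theorem lemma1 {S : Type*} [MeasurableSpace S] (P : Measure S) [IsProbabilityMeasure P]
    (M₁ M₂ : ℕ) (hM₁ : 1 ≤ M₁) (hM₂ : 1 ≤ M₂)
    (mh₁ Ωh₁ mh₂ Ωh₂ m₀ Ω₀ m₁ Ω₁ m₂ Ω₂ : ℝ)
    (hmh₁ : 0 < mh₁) (hΩh₁ : 0 < Ωh₁) (hmh₂ : 0 < mh₂) (hΩh₂ : 0 < Ωh₂)
    (hm₀ : 0 < m₀) (hΩ₀ : 0 < Ω₀) (hm₁ : 0 < m₁) (hΩ₁ : 0 < Ω₁) (hm₂ : 0 < m₂) (hΩ₂ : 0 < Ω₂)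
    (h₁ h₂ : S → ℂ) (gbar₁ g₁ : Fin M₁ → S → ℂ) (gbar₂ g₂ : Fin M₂ → S → ℂ)
    (link₁ : IsNakagamiLink P h₁ gbar₁ g₁ mh₁ Ωh₁ m₀ Ω₀ m₁ Ω₁)
    (link₂ : IsNakagamiLink P h₂ gbar₂ g₂ mh₂ Ωh₂ m₀ Ω₀ m₂ Ω₂)
    (β₁ β₂ ρ : ℝ) (hβ₁ : 0 < β₁) (hβ : β₁ ^ 2 + β₂ ^ 2 = 1) (hρ : 0 < ρ)
    (a₁ b₁ a₂ b₂ : ℝ)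
    (ha₁ : a₁ = fitA M₁ m₀ m₁) (hb₁ : b₁ = fitB m₀ Ω₀ m₁ Ω₁)
    (ha₂ : a₂ = fitA M₂ m₀ m₂) (hb₂ : b₂ = fitB m₀ Ω₀ m₂ Ω₂) :
    -- dropping the direct link bounds the ergodic rates from below
    (Integrable (rate (sinrDR1 β₁ ρ)) (P.map (gain h₁ gbar₁ g₁)) ∧
      Integrable (rate (sinrDR1 β₁ ρ)) (P.map (reflectedGain gbar₁ g₁)) ∧
      ergodicRate (P.map (reflectedGain gbar₁ g₁)) (sinrDR1 β₁ ρ) ≤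
        ergodicRate (P.map (gain h₁ gbar₁ g₁)) (sinrDR1 β₁ ρ)) ∧
    (Integrable (rate (sinrDR2 β₁ β₂ ρ)) (P.map (gain h₂ gbar₂ g₂)) ∧
      Integrable (rate (sinrDR2 β₁ β₂ ρ)) (P.map (reflectedGain gbar₂ g₂)) ∧
      ergodicRate (P.map (reflectedGain gbar₂ g₂)) (sinrDR2 β₁ β₂ ρ) ≤
        ergodicRate (P.map (gain h₂ gbar₂ g₂)) (sinrDR2 β₁ β₂ ρ)) ∧
    -- the approximate laws fit the gains without direct link
    (-1 < a₁ ∧ 0 < b₁ ∧ MatchesMeans (gainLaw a₁ b₁) (P.map (reflectedGain gbar₁ g₁))) ∧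
    (-1 < a₂ ∧ 0 < b₂ ∧ MatchesMeans (gainLaw a₂ b₂) (P.map (reflectedGain gbar₂ g₂))) ∧
    -- the ergodic rates under the approximate laws, in closed form
    Integrable (rate (sinrDR1 β₁ ρ)) (gainLaw a₁ b₁) ∧
    Integrable (rate (sinrDR2 β₁ β₂ ρ)) (gainLaw a₂ b₂) ∧
    ((∀ n : ℤ, a₁ ≠ n) →
      ergodicRate (gainLaw a₁ b₁) (sinrDR1 β₁ ρ) = closedFormDR1 a₁ b₁ β₁ ρ) ∧
    ((∀ n : ℤ, a₂ ≠ n) →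
      ergodicRate (gainLaw a₂ b₂) (sinrDR2 β₁ β₂ ρ) =
        closedFormDR2 a₂ b₂ (β₁ ^ 2 + β₂ ^ 2) (β₁ ^ 2) ρ) := by
  subst ha₁ hb₁ ha₂ hb₂
  obtain ⟨hA₁, hB₁, -, -⟩ := fit_params (m₀ := m₀) (Ω₀ := Ω₀) hM₁ hm₀ hΩ₀ hm₁ hΩ₁
  obtain ⟨hA₂, hB₂, -, -⟩ := fit_params (m₀ := m₀) (Ω₀ := Ω₀) hM₂ hm₀ hΩ₀ hm₂ hΩ₂
  have ha₁ : -1 < fitA M₁ m₀ m₁ := by linarith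
  have ha₂ : -1 < fitA M₂ m₀ m₂ := by linarith
  obtain ⟨hI₁, hR₁⟩ := ergodicRate_gainLaw_DR1 ha₁ hB₁ hβ₁ hρ
  obtain ⟨hI₂, hR₂⟩ := ergodicRate_gainLaw_DR2 (β₂ := β₂) ha₂ hB₂ hβ₁ hρ
  refine ⟨ergodicRate_DR1_mono link₁ hmh₁ hΩh₁ hm₀ hΩ₀ hm₁ hΩ₁ hρ,
    ergodicRate_DR2_mono link₂ hmh₂ hΩh₂ hm₀ hΩ₀ hm₂ hΩ₂ hρ,
    ⟨ha₁, hB₁, matchesMeans_gainLaw link₁ hM₁ hm₀ hΩ₀ hm₁ hΩ₁⟩,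
    ⟨ha₂, hB₂, matchesMeans_gainLaw link₂ hM₂ hm₀ hΩ₀ hm₂ hΩ₂⟩, hI₁, hI₂,
    fun hn => ?_, fun hn => ?_⟩
  · rw [hR₁, closedFormDR1_eq ha₁ hB₁ hβ₁ hρ hn]
  · rw [hR₂, closedFormDR2_eq ha₂ hB₂ (by positivity) (by positivity) hρ hn]
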